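/- Let $r\ge 1$ and let $\overline\Sigma_0$ be a covariance kernel on $[0,1]^2$ with spectral decomposition $\overline\Sigma_0(u,v)=\sum_{k\ge1}\overline\lambda_k\overline\psi_k(u)\overline\psi_k(v)$, where $\overline\lambda_1\ge\overline\lambda_2\ge\cdots\ge0$ are the eigenvalues and $\{\overline\psi_k\}$ are orthonormal eigenfunctions in $L^2[0,1]$. Suppose that $\overline\Sigma_0$ has rank $r$ (exactly $r$ nonzero eigenvalues, counted with multiplicity) and that the following hold. **A1.** $c_1\ge\overline\lambda_1>\cdots>\overline\lambda_r>\overline\lambda_{r+1}$ and $\max_{1\le j\le r}(\overline\lambda_j-\overline\lambda_{j+1})^{-1}\le c_2$ for finite constants $c_1,c_2$. **A2.** $\overline\psi_1,\dots,\overline\psi_r$ are four times continuously differentiable on $[0,1]$ and $\max_{1\le k\le r}\|\overline\psi_k^{(4)}\|_\infty\le C_0$ for some $0<C_0<\infty$. For each sample size $n$, let curve $i$ ($1\le i\le n$) be observed at random points $T_i=(T_{ij})_{1\le j\le m_i}$ (all quantities may depend on $n$), such that: **B1.** $\underline m\le m_i\le\overline m$ with $4\le\underline m$, $\overline m/\underline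 m\le d_2$ for some constant $d_2>0$, and $\overline m=O(n^\kappa)$ for some $\kappa\ge0$. **B2.** For each $i$, the points $T_{ij}$, $1\le j\le m_i$, are i.i.d. with a density $g$ on $[0,1]$ with $0<c_{g,0}\le g\le c_{g,1}<\infty$. For $M\geq 4$, let $\tilde{\boldsymbol\phi}=(\tilde\phi_1,\dots,\tilde\phi_M)^T$ be the cubic B-splines with the equally spaced knots $(j-3)/(M-3)$, $0\le j\le M+3$, let $G$ be their Gram matrix in $L^2[0,1]$, and let $\boldsymbol\phi=G^{-1/2}\tilde{\boldsymbol\phi}$ be the orthonormalized basis. The model space $\mathcal M_{M,r}$ consists of the kernels $\sum_{k=1}^r\lambda_k\psi_k(u)\psi_k(v)$ with $\lambda_1>\cdots>\lambda_r>0$ and $(\psi_1,\dots,\psi_r)=\boldsymbol\phi^TB$, $B\in\mathbb R^{M\times r}$, $B^TB=I_r$. An optimal parameter is a family $(B_*,\Lambda_*)=(B_{*,M},\Lambda_{*,M})$, $\Lambda_*=\mathrm{diag}(\lambda_{*1},\dots,\lambda_{*r})$, that defines, for all large $M$, an element $\Sigma_{*0}=\sum_{k=1}^r\lambda_{*k}\psi_{*k}(u)\psi_{*k}(v)$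 of $\mathcal M_{M,r}$ whose Hilbert–Schmidt error $\|\overline\Sigma_0-\Sigma_{*0}\|_F$ has the same rate in $M$ as the best approximation error $\inf_{C\in\mathcal M_{M,r}}\|\overline\Sigma_0-C\|_F$ (each is $O$ of the other as $M\to\infty$). With a fixed noise variance $\sigma^2>0$ put $\overline\Sigma_i=(\overline\Sigma_0(T_{ij},T_{ij'}))_{j,j'}+\sigma^2I_{m_i}$, $\Phi_i=[\boldsymbol\phi(T_{i1}):\cdots:\boldsymbol\phi(T_{im_i})]$, $\Sigma_{*i}=\Phi_i^TB_*\Lambda_*B_*^T\Phi_i+\sigma^2I_{m_i}$, and $$\overline\beta_n=\max_{1\le i\le n}\frac1{m_i}\|\overline\Sigma_i-\Sigma_{*i}\|_F ,$$ where $\|\cdot\|_F$ of a matrix is the Frobenius norm. Let $M=M_n\ge r$ satisfy $M^{-1}(n\overline m^2/\log n)^{1/9}=O(1)$ as $n\to\infty$. Then there is an optimal parameter $(B_*,\Lambda_*)$ with $$\max_{1\le k\le r}\|\overline\psi_k-\psi_{*k}\|_\infty=O(M^{-4})\quad\text{as } M\to\infty,$$ where the norm is the supremum over $[0,1]$, for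 which condition **C** holds: there is a nonrandom constant $K$ such that for all large $n$, almost surely, $$\overline m\,\overline\beta_n\le K\sqrt{\frac{M\log n}{n}} .$$ -/

import Mathlib

open MeasureTheory ProbabilityTheory Set Filter Asymptotics

open scoped Matrix

noncomputable section

namespace SparseFPCA

/-! ### Orthonormalized cubic B-splines with equally spaced knots -/

/-- The B-spline of degree `p` attached to the knots `t k ≤ ⋯ ≤ t (k + p + 1)`, by the
Cox–de Boor recursion. -/
def bspline (t : ℕ → ℝ) : ℕ → ℕ → ℝ → ℝ
  | 0, k, x => if t k ≤ x ∧ x < t (k + 1) then 1 else 0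
  | p + 1, k, x =>
      (x - t k) / (t (k + p + 1) - t k) * bspline t p k x +
      (t (k + p + 2) - x) / (t (k + p + 2) - t (k + 1)) * bspline t p (k + 1) x

/-- The equally spaced knots `(j - 3) / (M - 3)`, `j = 0, …, M + 3`. Knot `3` is `0` and knot `M`
is `1`, so that exactly `M` cubic B-splines live on `[0, 1]`. -/
def knot (M : ℕ) (j : ℕ) : ℝ := ((j : ℝ) - 3) / ((M : ℝ) - 3)

/-- The standard (not yet orthonormalized) cubic B-spline basis of size `M` on `[0, 1]`. -/
def cubicSpline (M : ℕ) (k : Fin M) (x : ℝ) : ℝ := bspline (knot M) 3 k x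

/-- The Gram matrix of the cubic B-splines in `L²[0, 1]`. -/
def gram (M : ℕ) : Matrix (Fin M) (Fin M) ℝ :=
  Matrix.of fun k l => ∫ x in (0 : ℝ)..1, cubicSpline M k x * cubicSpline M l x

theorem gram_isHermitian (M : ℕ) : (gram M).IsHermitian := by
  ext k l
  simp [gram, mul_comm]

/-- The matrix `G ^ (-1/2)` for the Gram matrix `G`, through its spectral decomposition. -/
def gramInvSqrt (M : ℕ) : Matrix (Fin M) (Fin M) ℝ :=
  (gram_isHermitian M).cfc fun x => (Real.sqrt x)⁻¹

/-- The orthonormalized cubic B-splines, as the vector `G ^ (-1/2) φ̃(x)`. -/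
def phi (M : ℕ) (x : ℝ) : Fin M → ℝ := gramInvSqrt M *ᵥ fun k => cubicSpline M k x

/-! ### Kernels, spectral decompositions, the model space -/

/-- `Sig` is a symmetric nonnegative kernel on `[0, 1]` with spectral decomposition
`Sig u v = ∑ lam k * psi k u * psi k v`. Indices start at `0`, so the eigenvalue usually called
`λ_k` is `lam (k - 1)`. -/
structure IsSpectralDecomposition (Sig : ℝ → ℝ → ℝ) (lam : ℕ → ℝ) (psi : ℕ → ℝ → ℝ) : Prop where
  nonneg : ∀ k, 0 ≤ lam k
  antitone : Antitone lam
  memLp : ∀ k, MemLp (psi k) 2 (volume.restrict (Icc (0 : ℝ) 1))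
  orthonormal : ∀ k l, ∫ x in (0 : ℝ)..1, psi k x * psi l x = if k = l then 1 else 0
  eigen : ∀ k, ∀ u ∈ Icc (0 : ℝ) 1, ∫ v in (0 : ℝ)..1, Sig u v * psi k v = lam k * psi k u
  expansion : ∀ u ∈ Icc (0 : ℝ) 1, ∀ v ∈ Icc (0 : ℝ) 1,
    HasSum (fun k => lam k * psi k u * psi k v) (Sig u v)

/-- The rank of a kernel with eigenvalues `lam` (listed with multiplicity): the number of nonzero
eigenvalues. -/
def spectralRank (lam : ℕ → ℝ) : ℕ∞ := {k | lam k ≠ 0}.encard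

/-- The Hilbert–Schmidt norm of a kernel on `[0, 1]`. -/
def hsNorm (C : ℝ → ℝ → ℝ) : ℝ :=
  Real.sqrt (∫ u in (0 : ℝ)..1, ∫ v in (0 : ℝ)..1, C u v ^ 2)

/-- The admissible parameters `(B, Λ)`: `Bᵀ B = I` and `λ₁ > ⋯ > λ_r > 0`. -/
def IsModelParameter {M r : ℕ} (B : Matrix (Fin M) (Fin r) ℝ) (L : Fin r → ℝ) : Prop :=
  Bᵀ * B = 1 ∧ StrictAnti L ∧ ∀ k, 0 < L k

/-- The functions `(ψ_{*1}(x), …, ψ_{*r}(x)) = φ(x)ᵀ B`. -/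
def psiStar {M r : ℕ} (B : Matrix (Fin M) (Fin r) ℝ) (k : Fin r) (x : ℝ) : ℝ :=
  (phi M x ᵥ* B) k

/-- The kernel `∑ λ_k ψ_{*k}(u) ψ_{*k}(v)` given by `(B, Λ)`. -/
def modelKernel {M r : ℕ} (B : Matrix (Fin M) (Fin r) ℝ) (L : Fin r → ℝ) (u v : ℝ) : ℝ :=
  ∑ k, L k * psiStar B k u * psiStar B k v

/-- The model space of rank-`r` kernels with eigenfunctions in the span of the spline basis. -/
def modelSpace (M r : ℕ) : Set (ℝ → ℝ → ℝ) :=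
  {C | ∃ (B : Matrix (Fin M) (Fin r) ℝ) (L : Fin r → ℝ),
    IsModelParameter B L ∧ C = modelKernel B L}

/-- The best approximation error of the model space, in Hilbert–Schmidt norm. -/
def bestApproxError (Sig : ℝ → ℝ → ℝ) (M r : ℕ) : ℝ :=
  sInf ((fun C => hsNorm (Sig - C)) '' modelSpace M r)

/-- A family `(B M, L M)` is an optimal parameter for `Sig`: it lies in the parameter space for all
large `M`, and its approximation error has the same rate, as a function of `M`, as the best
approximation error. -/
def IsOptimalParameter (Sig : ℝ → ℝ → ℝ) {r : ℕ} (B : ∀ M : ℕ, Matrix (Fin M) (Fin r) ℝ)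
    (L : ℕ → Fin r → ℝ) : Prop :=
  (∀ᶠ M in atTop, IsModelParameter (B M) (L M)) ∧
  (fun M : ℕ => hsNorm (Sig - modelKernel (B M) (L M))) =Θ[atTop]
    fun M : ℕ => bestApproxError Sig M r

/-! ### The assumptions on the kernel and on the design -/

/-- Bounded, separated leading eigenvalues. -/
structure CondA1 (r : ℕ) (lam : ℕ → ℝ) (c₁ c₂ : ℝ) : Prop where
  le_c₁ : lam 0 ≤ c₁
  strict : ∀ k < r, lam (k + 1) < lam k
  gap : ∀ k < r, (lam k - lam (k + 1))⁻¹ ≤ c₂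

/-- Smooth leading eigenfunctions with bounded fourth derivative. -/
structure CondA2 (r : ℕ) (psi : ℕ → ℝ → ℝ) (C₀ : ℝ) : Prop where
  pos : 0 < C₀
  contDiff : ∀ k < r, ContDiffOn ℝ 4 (psi k) (Icc 0 1)
  bound : ∀ k < r, ∀ x ∈ Icc (0 : ℝ) 1, |iteratedDerivWithin 4 (psi k) (Icc 0 1) x| ≤ C₀

/-- The numbers of measurements `m n i` of the `i`-th curve in a sample of `n` curves. -/
structure CondB1 (m : (n : ℕ) → Fin n → ℕ) (mlow mbar : ℕ → ℕ) (d₂ κ : ℝ) : Prop where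
  bounds : ∀ n i, mlow n ≤ m n i ∧ m n i ≤ mbar n
  four_le : ∀ n, 4 ≤ mlow n
  d₂_pos : 0 < d₂
  ratio : ∀ n, (mbar n : ℝ) / mlow n ≤ d₂
  κ_nonneg : 0 ≤ κ
  growth : (fun n => (mbar n : ℝ)) =O[atTop] fun n : ℕ => (n : ℝ) ^ κ

/-- The design points of each curve are i.i.d. with a density `g` on `[0, 1]` that is bounded and
bounded away from `0`. -/
structure CondB2 {Ω : Type*} [MeasurableSpace Ω] (P : Measure Ω) {m : (n : ℕ) → Fin n → ℕ}
    (T : (n : ℕ) → (i : Fin n) → Fin (m n i) → Ω → ℝ) (g : ℝ → ℝ) (cg₀ cg₁ : ℝ) : Prop where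
  measurable : ∀ n i j, Measurable (T n i j)
  indep : ∀ n i, iIndepFun (T n i) P
  g_measurable : Measurable g
  law : ∀ n i j, P.map (T n i j) =
    (volume.restrict (Icc (0 : ℝ) 1)).withDensity fun x => ENNReal.ofReal (g x)
  cg₀_pos : 0 < cg₀
  g_bounds : ∀ x ∈ Icc (0 : ℝ) 1, cg₀ ≤ g x ∧ g x ≤ cg₁

/-! ### The maximal approximation error and condition C -/

open scoped Matrix.Norms.Frobenius in
/-- The Frobenius norm of a matrix. -/
def frobNorm {a b : ℕ} (A : Matrix (Fin a) (Fin b) ℝ) : ℝ := ‖A‖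

/-- The covariance matrix `(Sig (t_j, t_j'))_{j,j'} + σ² I` of one curve observed at the points
`t`. -/
def trueCov (Sig : ℝ → ℝ → ℝ) (σ : ℝ) {a : ℕ} (t : Fin a → ℝ) : Matrix (Fin a) (Fin a) ℝ :=
  Matrix.of (fun j j' => Sig (t j) (t j')) + σ ^ 2 • (1 : Matrix (Fin a) (Fin a) ℝ)

/-- The `M × a` matrix with columns `φ(t_1), …, φ(t_a)`. -/
def designMatrix (M : ℕ) {a : ℕ} (t : Fin a → ℝ) : Matrix (Fin M) (Fin a) ℝ :=
  Matrix.of fun k j => phi M (t j) k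

/-- The approximating covariance matrix `Φᵀ B Λ Bᵀ Φ + σ² I`. -/
def approxCov {M r : ℕ} (B : Matrix (Fin M) (Fin r) ℝ) (L : Fin r → ℝ) (σ : ℝ) {a : ℕ}
    (t : Fin a → ℝ) : Matrix (Fin a) (Fin a) ℝ :=
  (designMatrix M t)ᵀ * B * Matrix.diagonal L * Bᵀ * designMatrix M t +
    σ ^ 2 • (1 : Matrix (Fin a) (Fin a) ℝ)

/-- The maximal approximation error: the maximum over the curves `i` of `1 / m_i` times the
Frobenius distance of the two covariance matrices. -/
def maxApproxError (Sig : ℝ → ℝ → ℝ) {M r : ℕ} (B : Matrix (Fin M) (Fin r) ℝ) (L : Fin r → ℝ)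
    (σ : ℝ) {n : ℕ} {m : Fin n → ℕ} (t : (i : Fin n) → Fin (m i) → ℝ) : ℝ :=
  ⨆ i : Fin n, 1 / (m i : ℝ) * frobNorm (trueCov Sig σ (t i) - approxCov B L σ (t i))

/-- Condition C, `m̄ β̄_n = O(√(M log n / n))`. The error `β̄_n` is a function of the random design;
the bound holds almost surely with a nonrandom constant and for all `n` beyond a nonrandom
threshold. -/
def CondC {Ω : Type*} [MeasurableSpace Ω] (P : Measure Ω) (Sig : ℝ → ℝ → ℝ) {r : ℕ}
    (B : ∀ M : ℕ, Matrix (Fin M) (Fin r) ℝ) (L : ℕ → Fin r → ℝ) (σ : ℝ)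
    {m : (n : ℕ) → Fin n → ℕ} (T : (n : ℕ) → (i : Fin n) → Fin (m n i) → Ω → ℝ)
    (mbar M : ℕ → ℕ) : Prop :=
  ∃ K : ℝ, ∀ᶠ n : ℕ in atTop, ∀ᵐ ω ∂P,
    (mbar n : ℝ) * maxApproxError Sig (B (M n)) (L (M n)) σ (fun i j => T n i j ω)
      ≤ K * Real.sqrt ((M n : ℝ) * Real.log n / n)

end SparseFPCA

end

/-! The rank is `r`, so on the unit square the kernel is `∑ λ_k ψ_k ⊗ ψ_k` over `r` terms. The
approximant keeps the true eigenvalues and replaces the `ψ_k` by orthonormal splines. These come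
from a quasi-interpolation `Q`: a local linear projection onto the splines, built from dual
functionals that live on single cells. `Q` reproduces cubics and is bounded on `L²` uniformly in the
number `n` of cells (`n = M - 3`). Locality and Taylor expansion give `‖Qψ_k - ψ_k‖_∞ = O(n⁻⁴)`
(`abs_quasiInterp_sub_le`), and `L²` boundedness makes `Q` optimal in `L²` up to a constant
(`sqInt_sub_quasiInterp_le`).

The functions `Qψ_k` are made orthonormal by the inverse square root of their Gram matrix. With `ε²
= ∑ ‖Qψ_k - ψ_k‖²` that matrix is within `O(ε)` of the identity, and so is its inverse square root
(`exists_orthonormal_splines`). The correction therefore preserves the uniform rate, and the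
Hilbert–Schmidt error of the approximant is `O(ε)`.

Optimality needs more than the rate `n⁻⁴`, because the best error may be far smaller. If `C` is any
kernel with eigenfunctions in the spline space, `Σ - C` maps `ψ_k` to `λ_k` times the difference of
`ψ_k` and a spline. Hence the distance of `ψ_k` to the splines is at most `‖Σ - C‖ / λ_k`, and
near-optimality of `Q` gives `ε = O(‖Σ - C‖)` (`sqInt_sub_quasiInterp_le_hsNorm`).

For condition C, the uniform rate bounds every entry of the sampled difference by `O(M⁻⁴)`, and the
factor `1 / m_i` absorbs the size of the matrix. What remains is `m̄ M⁻⁴ = O(√(M log n / n))`, which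
after squaring is `n m̄² / log n = O(M⁹)`: the growth hypothesis on `M`. -/

namespace SparseFPCA

/-! ### The cardinal cubic B-spline -/

/-- The B-splines with integer knots, by the Cox–de Boor recursion. -/
noncomputable def cardinalSpline : ℕ → ℝ → ℝ
  | 0, y => if 0 ≤ y ∧ y < 1 then 1 else 0
  | p + 1, y =>
      y / (p + 1) * cardinalSpline p y + (p + 2 - y) / (p + 1) * cardinalSpline p (y - 1)

/-- For equally spaced knots the substitution `y = n x + 3 - k` turns the recursions of all the
B-splines into a single one, so each is a translated and dilated copy of one function. -/
theorem bspline_knot {n : ℕ} (hn : 0 < n) (p k : ℕ) (x : ℝ) :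
    bspline (knot (n + 3)) p k x = cardinalSpline p (n * x + 3 - k) := by
  have h0 : (0 : ℝ) < n := by exact_mod_cast hn
  have hk : ∀ j : ℕ, knot (n + 3) j = ((j : ℝ) - 3) / n := by
    intro j; simp [knot]
  induction p generalizing k with
  | zero =>
    simp only [bspline, cardinalSpline, hk]
    congr 1
    rw [div_le_iff₀ h0, lt_div_iff₀ h0, eq_iff_iff]
    push_cast
    constructor <;> rintro ⟨h1, h2⟩ <;> constructor <;> linarith
  | succ p ih =>
    simp only [bspline, cardinalSpline, ih, hk]
    have e1 : (x - ((k : ℝ) - 3) / n) / ((((k + p + 1 : ℕ) : ℝ) - 3) / n - ((k : ℝ) - 3) / n)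
        = (n * x + 3 - k) / (p + 1) := by
      have : (((k + p + 1 : ℕ) : ℝ) - 3) / n - ((k : ℝ) - 3) / n = (p + 1) / n := by
        push_cast; ring
      rw [this]
      have hp : (p : ℝ) + 1 ≠ 0 := by positivity
      field_simp
      ring
    have e2 : ((((k + p + 2 : ℕ) : ℝ) - 3) / n - x) /
        ((((k + p + 2 : ℕ) : ℝ) - 3) / n - (((k + 1 : ℕ) : ℝ) - 3) / n)
        = (p + 2 - (n * x + 3 - k)) / (p + 1) := by
      have : (((k + p + 2 : ℕ) : ℝ) - 3) / n - (((k + 1 : ℕ) : ℝ) - 3) / n = (p + 1) / n := by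
        push_cast; ring
      rw [this]
      have hp : (p : ℝ) + 1 ≠ 0 := by positivity
      push_cast
      field_simp
      ring
    rw [e1, e2]
    have e3 : (n : ℝ) * x + 3 - ((k + 1 : ℕ) : ℝ) = n * x + 3 - k - 1 := by push_cast; ring
    rw [e3]

/-- The cubic B-spline with knots `0, 1, 2, 3, 4`, in terms of truncated powers. -/
noncomputable def cubicCardinal (y : ℝ) : ℝ :=
  (max y 0 ^ 3 - 4 * max (y - 1) 0 ^ 3 + 6 * max (y - 2) 0 ^ 3 - 4 * max (y - 3) 0 ^ 3
    + max (y - 4) 0 ^ 3) / 6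

theorem cardinalSpline_three (y : ℝ) : cardinalSpline 3 y = cubicCardinal y := by
  simp only [cardinalSpline, cubicCardinal]
  have key : y < 0 ∨ (0 ≤ y ∧ y < 1) ∨ (1 ≤ y ∧ y < 2) ∨ (2 ≤ y ∧ y < 3) ∨ (3 ≤ y ∧ y < 4)
      ∨ 4 ≤ y := by
    rcases lt_or_ge y 0 with h | h
    · exact Or.inl h
    rcases lt_or_ge y 1 with h1 | h1
    · exact Or.inr (Or.inl ⟨h, h1⟩)
    rcases lt_or_ge y 2 with h2 | h2
    · exact Or.inr (Or.inr (Or.inl ⟨h1, h2⟩))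
    rcases lt_or_ge y 3 with h3 | h3
    · exact Or.inr (Or.inr (Or.inr (Or.inl ⟨h2, h3⟩)))
    rcases lt_or_ge y 4 with h4 | h4
    · exact Or.inr (Or.inr (Or.inr (Or.inr (Or.inl ⟨h3, h4⟩))))
    · exact Or.inr (Or.inr (Or.inr (Or.inr (Or.inr h4))))
  have i0 : ∀ z : ℝ, z < 0 → (if 0 ≤ z ∧ z < 1 then (1 : ℝ) else 0) = 0 := fun z hz =>
    if_neg fun h => absurd h.1 (not_le.2 hz)
  have i1 : ∀ z : ℝ, 0 ≤ z → z < 1 → (if 0 ≤ z ∧ z < 1 then (1 : ℝ) else 0) = 1 := fun z h h' =>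
    if_pos ⟨h, h'⟩
  have i2 : ∀ z : ℝ, 1 ≤ z → (if 0 ≤ z ∧ z < 1 then (1 : ℝ) else 0) = 0 := fun z hz =>
    if_neg fun h => absurd h.2 (not_lt.2 hz)
  have m0 : ∀ z : ℝ, z ≤ 0 → max z 0 = 0 := fun z h => max_eq_right h
  have m1 : ∀ z : ℝ, 0 ≤ z → max z 0 = z := fun z h => max_eq_left h
  rcases key with h | ⟨h, h'⟩ | ⟨h, h'⟩ | ⟨h, h'⟩ | ⟨h, h'⟩ | h
  · rw [i0 y (by linarith), i0 (y - 1) (by linarith), i0 (y - 1 - 1) (by linarith),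
      i0 (y - 1 - 1 - 1) (by linarith), m0 y (by linarith), m0 (y - 1) (by linarith),
      m0 (y - 2) (by linarith), m0 (y - 3) (by linarith), m0 (y - 4) (by linarith)]
    ring
  · rw [i1 y (by linarith) (by linarith), i0 (y - 1) (by linarith), i0 (y - 1 - 1) (by linarith),
      i0 (y - 1 - 1 - 1) (by linarith), m1 y (by linarith), m0 (y - 1) (by linarith),
      m0 (y - 2) (by linarith), m0 (y - 3) (by linarith), m0 (y - 4) (by linarith)]
    push_cast; ring
  · rw [i2 y (by linarith), i1 (y - 1) (by linarith) (by linarith), i0 (y - 1 - 1) (by linarith),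
      i0 (y - 1 - 1 - 1) (by linarith), m1 y (by linarith), m1 (y - 1) (by linarith),
      m0 (y - 2) (by linarith), m0 (y - 3) (by linarith), m0 (y - 4) (by linarith)]
    push_cast; ring
  · rw [i2 y (by linarith), i2 (y - 1) (by linarith), i1 (y - 1 - 1) (by linarith) (by linarith),
      i0 (y - 1 - 1 - 1) (by linarith), m1 y (by linarith), m1 (y - 1) (by linarith),
      m1 (y - 2) (by linarith), m0 (y - 3) (by linarith), m0 (y - 4) (by linarith)]
    push_cast; ring
  · rw [i2 y (by linarith), i2 (y - 1) (by linarith), i2 (y - 1 - 1) (by linarith),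
      i1 (y - 1 - 1 - 1) (by linarith) (by linarith), m1 y (by linarith), m1 (y - 1) (by linarith),
      m1 (y - 2) (by linarith), m1 (y - 3) (by linarith), m0 (y - 4) (by linarith)]
    push_cast; ring
  · rw [i2 y (by linarith), i2 (y - 1) (by linarith), i2 (y - 1 - 1) (by linarith),
      i2 (y - 1 - 1 - 1) (by linarith), m1 y (by linarith), m1 (y - 1) (by linarith),
      m1 (y - 2) (by linarith), m1 (y - 3) (by linarith), m1 (y - 4) (by linarith)]
    ring

theorem continuous_cubicCardinal : Continuous cubicCardinal := by
  unfold cubicCardinal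
  fun_prop

/-- The polynomial pieces on `[0, 1]` of the cubic cardinal B-splines that do not vanish there. -/
noncomputable def cubicPiece : ℕ → ℝ → ℝ
  | 0, s => 1 / 6 + (-1 / 2) * s + (1 / 2) * s ^ 2 + (-1 / 6) * s ^ 3
  | 1, s => 4 / 6 + 0 * s + (-1) * s ^ 2 + (1 / 2) * s ^ 3
  | 2, s => 1 / 6 + (1 / 2) * s + (1 / 2) * s ^ 2 + (-1 / 2) * s ^ 3
  | 3, s => 0 + 0 * s + 0 * s ^ 2 + (1 / 6) * s ^ 3
  | _ + 4, _ => 0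

/-- The truncated powers fit together continuously at the knots, so both ends of the cell are
allowed, although the recursion starts from half-open intervals. This lets the point `1` belong to
the last cell. -/
theorem cubicCardinal_eq_piece {s : ℝ} (h0 : 0 ≤ s) (h1 : s ≤ 1) (l : ℕ) :
    cubicCardinal (s + 3 - l) = cubicPiece l s := by
  have m0 : ∀ z : ℝ, z ≤ 0 → max z 0 = 0 := fun z h => max_eq_right h
  have m1 : ∀ z : ℝ, 0 ≤ z → max z 0 = z := fun z h => max_eq_left h
  unfold cubicCardinal
  match l with
  | 0 =>
    simp only [cubicPiece, Nat.cast_zero]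
    rw [m1 _ (by linarith), m1 (s + 3 - 0 - 1) (by linarith), m1 (s + 3 - 0 - 2) (by linarith),
      m1 (s + 3 - 0 - 3) (by linarith), m0 (s + 3 - 0 - 4) (by linarith)]
    ring
  | 1 =>
    simp only [cubicPiece, Nat.cast_one]
    rw [m1 _ (by linarith), m1 (s + 3 - 1 - 1) (by linarith), m1 (s + 3 - 1 - 2) (by linarith),
      m0 (s + 3 - 1 - 3) (by linarith), m0 (s + 3 - 1 - 4) (by linarith)]
    ring
  | 2 =>
    simp only [cubicPiece, Nat.cast_ofNat]
    rw [m1 _ (by linarith), m1 (s + 3 - 2 - 1) (by linarith), m0 (s + 3 - 2 - 2) (by linarith),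
      m0 (s + 3 - 2 - 3) (by linarith), m0 (s + 3 - 2 - 4) (by linarith)]
    ring
  | 3 =>
    simp only [cubicPiece, Nat.cast_ofNat]
    rw [m1 _ (by linarith), m0 (s + 3 - 3 - 1) (by linarith), m0 (s + 3 - 3 - 2) (by linarith),
      m0 (s + 3 - 3 - 3) (by linarith), m0 (s + 3 - 3 - 4) (by linarith)]
    ring
  | l + 4 =>
    simp only [cubicPiece, Nat.cast_add, Nat.cast_ofNat]
    have : (0 : ℝ) ≤ l := by positivity
    rw [m0 _ (by linarith), m0 _ (by linarith), m0 _ (by linarith), m0 _ (by linarith),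
      m0 _ (by linarith)]
    ring

theorem cubicCardinal_eq_zero {y : ℝ} (h : 4 ≤ y) : cubicCardinal y = 0 := by
  unfold cubicCardinal
  rw [max_eq_left (by linarith), max_eq_left (by linarith), max_eq_left (by linarith),
    max_eq_left (by linarith), max_eq_left (by linarith)]
  ring

theorem cubicPiece_nonneg {s : ℝ} (h0 : 0 ≤ s) (h1 : s ≤ 1) (l : ℕ) : 0 ≤ cubicPiece l s := by
  match l with
  | 0 =>
    have : 0 ≤ (1 - s) ^ 3 := pow_nonneg (by linarith) 3
    simp only [cubicPiece]; nlinarith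
  | 1 =>
    have : 0 ≤ (1 - s) * (1 + s - s ^ 2) := mul_nonneg (by linarith) (by nlinarith)
    have : 0 ≤ (1 - s) * (1 - s) := mul_nonneg (by linarith) (by linarith)
    simp only [cubicPiece]; nlinarith [pow_nonneg h0 3]
  | 2 =>
    have : 0 ≤ s ^ 2 * (1 - s) := mul_nonneg (by positivity) (by linarith)
    simp only [cubicPiece]; nlinarith
  | 3 => simp only [cubicPiece]; positivity
  | l + 4 => exact le_rfl

theorem sum_cubicPiece (s : ℝ) : ∑ l ∈ Finset.range 4, cubicPiece l s = 1 := by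
  simp only [Finset.sum_range_succ, Finset.sum_range_zero, cubicPiece]
  ring

/-! ### The B-splines with equally spaced knots, cell by cell -/

/-- The `k`-th cubic B-spline for the division of `[0, 1]` into `n` cells. -/
noncomputable def uniformSpline (n k : ℕ) (x : ℝ) : ℝ := cubicCardinal (n * x + 3 - k)

theorem cubicSpline_eq {n : ℕ} (hn : 0 < n) (k : Fin (n + 3)) (x : ℝ) :
    cubicSpline (n + 3) k x = uniformSpline n k x := by
  rw [cubicSpline, bspline_knot hn, cardinalSpline_three, uniformSpline]

theorem continuous_uniformSpline (n k : ℕ) : Continuous (uniformSpline n k) := by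
  unfold uniformSpline
  exact continuous_cubicCardinal.comp (by fun_prop)

theorem exists_cell {n : ℕ} (hn : 0 < n) {x : ℝ} (hx : x ∈ Icc (0 : ℝ) 1) :
    ∃ q < n, ∃ s ∈ Icc (0 : ℝ) 1, x = (s + q) / n := by
  have h0 : (0 : ℝ) < n := by exact_mod_cast hn
  rcases eq_or_lt_of_le hx.2 with h | h
  · refine ⟨n - 1, by omega, 1, ⟨zero_le_one, le_rfl⟩, ?_⟩
    rw [Nat.cast_sub hn, h]
    field_simp
    simp
  · have hnx : 0 ≤ n * x := mul_nonneg h0.le hx.1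
    refine ⟨⌊n * x⌋₊, ?_, n * x - ⌊n * x⌋₊, ⟨?_, ?_⟩, ?_⟩
    · rw [Nat.floor_lt hnx]
      nlinarith
    · linarith [Nat.floor_le hnx]
    · linarith [Nat.lt_floor_add_one (n * x)]
    · field_simp
      ring

theorem cell_mem {n q : ℕ} (hq : q < n) {s : ℝ} (hs : s ∈ Icc (0 : ℝ) 1) :
    (s + q) / n ∈ Icc (0 : ℝ) 1 := by
  have h0 : (0 : ℝ) < n := by exact_mod_cast (by omega : 0 < n)
  have h1 : (q : ℝ) + 1 ≤ n := by exact_mod_cast hq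
  refine ⟨div_nonneg (add_nonneg hs.1 (by positivity)) h0.le, ?_⟩
  rw [div_le_one h0]
  linarith [hs.2]

theorem uniformSpline_cell {n : ℕ} (hn : 0 < n) (q l : ℕ) {s : ℝ} (hs : s ∈ Icc (0 : ℝ) 1) :
    uniformSpline n (q + l) ((s + q) / n) = cubicPiece l s := by
  have h0 : (n : ℝ) ≠ 0 := by exact_mod_cast hn.ne'
  rw [← cubicCardinal_eq_piece hs.1 hs.2, uniformSpline]
  congr 1
  push_cast
  field_simp
  ring

theorem uniformSpline_cell_eq_zero {n : ℕ} (hn : 0 < n) {q k : ℕ} (hk : k < q) {s : ℝ}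
    (hs : s ∈ Icc (0 : ℝ) 1) : uniformSpline n k ((s + q) / n) = 0 := by
  have h0 : (n : ℝ) ≠ 0 := by exact_mod_cast hn.ne'
  apply cubicCardinal_eq_zero
  have : (k : ℝ) + 1 ≤ q := by exact_mod_cast hk
  rw [mul_div_cancel₀ _ h0]
  linarith [hs.1]

/-- Only the splines `q, …, q + 3` are nonzero on the cell `q`; every local estimate below rests on
this. -/
theorem sum_uniformSpline_cell {n q : ℕ} (hq : q < n) (c : ℕ → ℝ) {s : ℝ}
    (hs : s ∈ Icc (0 : ℝ) 1) :
    ∑ k ∈ Finset.range (n + 3), c k * uniformSpline n k ((s + q) / n) =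
      ∑ l ∈ Finset.range 4, c (q + l) * cubicPiece l s := by
  have hn : 0 < n := by omega
  obtain ⟨d, rfl⟩ : ∃ d, n = q + 1 + d := ⟨n - (q + 1), by omega⟩
  rw [show q + 1 + d + 3 = q + (4 + d) by ring, Finset.sum_range_add, Finset.sum_range_add _ 4 d,
    Finset.sum_eq_zero, zero_add, Finset.sum_eq_zero (s := Finset.range d), add_zero]
  · refine Finset.sum_congr rfl fun l _ => ?_
    rw [uniformSpline_cell hn q l hs]
  · intro l _
    rw [uniformSpline_cell hn q (4 + l) hs, add_comm 4 l]
    simp [cubicPiece]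
  · intro k hk
    rw [uniformSpline_cell_eq_zero hn (Finset.mem_range.1 hk) hs, mul_zero]

/-- Marsden's identity: cubic polynomials are splines. -/
theorem exists_spline_eq_cubic {n : ℕ} (hn : 0 < n) (a : ℕ → ℝ) :
    ∃ c : ℕ → ℝ, ∀ x ∈ Icc (0 : ℝ) 1,
      ∑ k ∈ Finset.range (n + 3), c k * uniformSpline n k x =
        ∑ j ∈ Finset.range 4, a j * x ^ j := by
  have h0 : (n : ℝ) ≠ 0 := by exact_mod_cast hn.ne'
  -- The interior knots of the `k`-th spline are `(k - 2) / n`, `(k - 1) / n`, `k / n`. Its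
  -- coefficient is the polar form of the polynomial at these knots: `x`, `x²`, `x³` become their
  -- mean, the mean of their pairwise products, and their product.
  refine ⟨fun k => a 0 + a 1 / n * (k - 1) +
    a 2 / n ^ 2 * (((k - 2) * (k - 1) + (k - 2) * k + (k - 1) * k) / 3) +
    a 3 / n ^ 3 * ((k - 2) * (k - 1) * k), fun x hx => ?_⟩
  obtain ⟨q, hq, s, hs, rfl⟩ := exists_cell hn hx
  rw [sum_uniformSpline_cell hq _ hs]
  simp only [Finset.sum_range_succ, Finset.sum_range_zero, cubicPiece]
  push_cast
  field_simp
  ring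

/-! ### Dual functionals -/

/-- The cubic polynomials on `[0, 1]` that are dual to the pieces `cubicPiece`. -/
noncomputable def dualPiece : ℕ → ℝ → ℝ
  | 0, s => 296 + (-3120) * s + 7260 * s ^ 2 + (-4620) * s ^ 3
  | 1, s => (-64) + 780 * s + (-1920) * s ^ 2 + 1260 * s ^ 3
  | 2, s => 56 + (-720) * s + 1860 * s ^ 2 + (-1260) * s ^ 3
  | 3, s => (-184) + 2460 * s + (-6600) * s ^ 2 + 4620 * s ^ 3
  | _ + 4, _ => 0

theorem continuous_dualPiece (l : ℕ) : Continuous (dualPiece l) := by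
  match l with
  | 0 | 1 | 2 | 3 | l + 4 => unfold dualPiece; fun_prop

theorem integral_cubic_mul_cubic (a b c d a' b' c' d' : ℝ) :
    ∫ s in (0 : ℝ)..1, (a + b * s + c * s ^ 2 + d * s ^ 3) *
      (a' + b' * s + c' * s ^ 2 + d' * s ^ 3) =
    a * a' + (a * b' + b * a') / 2 + (a * c' + b * b' + c * a') / 3 +
      (a * d' + b * c' + c * b' + d * a') / 4 + (b * d' + c * c' + d * b') / 5 +
      (c * d' + d * c') / 6 + d * d' / 7 := by
  have h : ∀ x : ℝ, HasDerivAt (fun s : ℝ => a * a' * s + (a * b' + b * a') / 2 * s ^ 2 +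
      (a * c' + b * b' + c * a') / 3 * s ^ 3 + (a * d' + b * c' + c * b' + d * a') / 4 * s ^ 4 +
      (b * d' + c * c' + d * b') / 5 * s ^ 5 + (c * d' + d * c') / 6 * s ^ 6 +
      d * d' / 7 * s ^ 7)
      ((a + b * x + c * x ^ 2 + d * x ^ 3) * (a' + b' * x + c' * x ^ 2 + d' * x ^ 3)) x := by
    intro x
    have hp : ∀ (n : ℕ) (α : ℝ), HasDerivAt (fun s : ℝ => α * s ^ (n + 1))
        (α * (((n + 1 : ℕ) : ℝ) * x ^ n)) x := fun n α => by
      simpa using (hasDerivAt_pow (n + 1) x).const_mul α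
    have h1 : HasDerivAt (fun s : ℝ => a * a' * s) (a * a') x := by
      simpa using (hasDerivAt_id x).const_mul (a * a')
    refine ((((((h1.add (hp 1 _)).add (hp 2 _)).add (hp 3 _)).add (hp 4 _)).add (hp 5 _)).add
      (hp 6 _)).congr_deriv ?_
    push_cast
    ring
  rw [intervalIntegral.integral_eq_sub_of_hasDerivAt (fun x _ => h x)
    (Continuous.intervalIntegrable (by fun_prop) _ _)]
  ring

/-- For each `l` this is a `4 × 4` linear system, and the coefficients in `dualPiece` are its
solution. -/
theorem integral_dualPiece_mul_cubicPiece {l : ℕ} (hl : l < 4) (j : ℕ) :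
    ∫ s in (0 : ℝ)..1, dualPiece l s * cubicPiece j s = if l = j then 1 else 0 := by
  match j with
  | 0 | 1 | 2 | 3 =>
    interval_cases l <;> simp only [dualPiece, cubicPiece] <;> rw [integral_cubic_mul_cubic] <;>
      norm_num
  | j + 4 =>
    rw [if_neg (by omega)]
    simp [cubicPiece]

theorem abs_dualPiece_le {s : ℝ} (hs : s ∈ Icc (0 : ℝ) 1) (l : ℕ) : |dualPiece l s| ≤ 16000 := by
  obtain ⟨h0, h1⟩ := hs
  have h2 : s ^ 2 ≤ 1 := pow_le_one₀ h0 h1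
  have h3 : s ^ 3 ≤ 1 := pow_le_one₀ h0 h1
  have h2' : 0 ≤ s ^ 2 := by positivity
  have h3' : 0 ≤ s ^ 3 := by positivity
  match l with
  | 0 | 1 | 2 | 3 =>
    -- The largest sum of absolute values of the coefficients is `15296`, for `l = 0`.
    simp only [dualPiece]
    rw [abs_le]
    constructor <;> linarith
  | l + 4 => simp [dualPiece]

/-! ### Square integrals on the unit interval -/

/-- The squared norm of a function in `L²[0, 1]`. -/
noncomputable def sqInt (f : ℝ → ℝ) : ℝ := ∫ x in (0 : ℝ)..1, f x ^ 2

theorem sqInt_nonneg (f : ℝ → ℝ) : 0 ≤ sqInt f :=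
  intervalIntegral.integral_nonneg zero_le_one fun _ _ => sq_nonneg _

/-- Cauchy–Schwarz: the quadratic `t ↦ ‖t f + g‖²` is nonnegative, so its discriminant is not
positive. -/
theorem sq_integral_mul_le {f g : ℝ → ℝ} (hf : Continuous f) (hg : Continuous g) :
    (∫ x in (0 : ℝ)..1, f x * g x) ^ 2 ≤ sqInt f * sqInt g := by
  have key : ∀ t : ℝ, 0 ≤ sqInt f * (t * t) + (2 * ∫ x in (0 : ℝ)..1, f x * g x) * t + sqInt g := by
    intro t
    have h : ∫ x in (0 : ℝ)..1, (t * f x + g x) ^ 2 =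
        sqInt f * (t * t) + (2 * ∫ x in (0 : ℝ)..1, f x * g x) * t + sqInt g := by
      have e : ∀ x, (t * f x + g x) ^ 2 = t * t * f x ^ 2 + 2 * t * (f x * g x) + g x ^ 2 := by
        intro x; ring
      simp only [e]
      rw [intervalIntegral.integral_add, intervalIntegral.integral_add,
        intervalIntegral.integral_const_mul, intervalIntegral.integral_const_mul, sqInt, sqInt]
      · ring
      all_goals exact Continuous.intervalIntegrable (by fun_prop) _ _
    rw [← h]
    exact sqInt_nonneg fun x => t * f x + g x
  have := discrim_le_zero key
  rw [discrim] at this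
  nlinarith

theorem sqInt_add_le {f g : ℝ → ℝ} (hf : Continuous f) (hg : Continuous g) :
    sqInt (fun x => f x + g x) ≤ 2 * sqInt f + 2 * sqInt g := by
  unfold sqInt
  rw [← intervalIntegral.integral_const_mul, ← intervalIntegral.integral_const_mul,
    ← intervalIntegral.integral_add]
  · refine intervalIntegral.integral_mono_on zero_le_one ?_ ?_ fun x _ => ?_
    · exact Continuous.intervalIntegrable (by fun_prop) _ _
    · exact Continuous.intervalIntegrable (by fun_prop) _ _
    · nlinarith [sq_nonneg (f x - g x)]
  all_goals exact Continuous.intervalIntegrable (by fun_prop) _ _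

theorem sqInt_const_mul (c : ℝ) (f : ℝ → ℝ) : sqInt (fun x => c * f x) = c ^ 2 * sqInt f := by
  unfold sqInt
  rw [← intervalIntegral.integral_const_mul]
  congr 1
  ext x
  ring

theorem sqInt_congr {f g : ℝ → ℝ} (h : ∀ x ∈ Icc (0 : ℝ) 1, f x = g x) : sqInt f = sqInt g := by
  unfold sqInt
  refine intervalIntegral.integral_congr fun x hx => ?_
  rw [uIcc_of_le zero_le_one] at hx
  simp only [h x hx]

theorem sqInt_le {f : ℝ → ℝ} (hf : Continuous f) {b : ℝ} (h : ∀ x ∈ Icc (0 : ℝ) 1, |f x| ≤ b) :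
    sqInt f ≤ b ^ 2 := by
  have : ∫ _ in (0 : ℝ)..1, b ^ 2 = b ^ 2 := by simp
  rw [← this]
  refine intervalIntegral.integral_mono_on zero_le_one ?_ ?_ fun x hx => ?_
  · exact Continuous.intervalIntegrable (by fun_prop) _ _
  · exact Continuous.intervalIntegrable (by fun_prop) _ _
  · exact sq_le_sq' (by linarith [abs_le.1 (h x hx)]) (abs_le.1 (h x hx)).2

theorem sum_integral_cells {n : ℕ} (hn : 0 < n) {f : ℝ → ℝ} (hf : Continuous f) :
    ∑ q ∈ Finset.range n, ∫ s in (0 : ℝ)..1, f ((s + q) / n) = n * ∫ x in (0 : ℝ)..1, f x := by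
  have h0 : (n : ℝ) ≠ 0 := by exact_mod_cast hn.ne'
  have h := intervalIntegral.sum_integral_adjacent_intervals (f := f) (μ := volume)
    (a := fun k : ℕ => (k : ℝ) / n) (n := n) fun k _ => hf.intervalIntegrable _ _
  simp only [Nat.cast_zero, zero_div, div_self h0] at h
  rw [← h, Finset.mul_sum]
  refine Finset.sum_congr rfl fun q _ => ?_
  have := intervalIntegral.integral_comp_div_add (a := 0) (b := 1) f h0 ((q : ℝ) / n)
  simp only [smul_eq_mul] at this
  simp only [add_div]
  rw [this]
  push_cast
  congr 2 <;> ring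

/-! ### The quasi-interpolating projection onto the splines -/

/-- The `i`-th dual functional of the B-splines on `n` cells, supported on the cell `i - 3`. -/
noncomputable def dualCoef (n : ℕ) (f : ℝ → ℝ) (i : ℕ) : ℝ :=
  ∫ s in (0 : ℝ)..1, dualPiece (i - (i - 3)) s * f ((s + (i - 3 : ℕ)) / n)

/-- A local linear projection onto the splines on `n` cells. -/
noncomputable def quasiInterp (n : ℕ) (f : ℝ → ℝ) (x : ℝ) : ℝ :=
  ∑ i ∈ Finset.range (n + 3), dualCoef n f i * uniformSpline n i x

theorem continuous_quasiInterp (n : ℕ) (f : ℝ → ℝ) : Continuous (quasiInterp n f) :=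
  continuous_finsetSum _ fun i _ => (continuous_uniformSpline n i).const_mul _

/-- By truncated subtraction the functional `i` uses the cell `0` and the piece `i` when `i < 3`,
and the cell `i - 3` and the piece `3` otherwise. On that cell the splines below `i - 3` vanish and
the others are the pieces `k - (i - 3)`, so duality of the pieces decides. -/
theorem dualCoef_uniformSpline {n : ℕ} (hn : 0 < n) (i k : ℕ) :
    dualCoef n (uniformSpline n k) i = if i = k then 1 else 0 := by
  unfold dualCoef
  rcases lt_or_ge k (i - 3) with h | h
  · rw [if_neg (by omega)]
    refine (intervalIntegral.integral_congr (g := fun _ => 0) fun s hs => ?_).trans (by simp)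
    rw [uIcc_of_le zero_le_one] at hs
    simp only [uniformSpline_cell_eq_zero hn h hs, mul_zero]
  · obtain ⟨l, hl⟩ := Nat.exists_eq_add_of_le h
    rw [intervalIntegral.integral_congr
      (g := fun s => dualPiece (i - (i - 3)) s * cubicPiece l s) fun s hs => ?_,
      integral_dualPiece_mul_cubicPiece (by omega)]
    · congr 1
      rw [eq_iff_iff]
      omega
    · rw [uIcc_of_le zero_le_one] at hs
      simp only [hl, uniformSpline_cell hn _ _ hs]

theorem dualCoef_sub {f g : ℝ → ℝ} (hf : Continuous f) (hg : Continuous g) (n i : ℕ) :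
    dualCoef n (fun x => f x - g x) i = dualCoef n f i - dualCoef n g i := by
  have hw := continuous_dualPiece (i - (i - 3))
  unfold dualCoef
  rw [← intervalIntegral.integral_sub]
  · simp only [mul_sub]
  all_goals exact Continuous.intervalIntegrable (by fun_prop) _ _

theorem dualCoef_sum {n : ℕ} (hn : 0 < n) (c : ℕ → ℝ) {i : ℕ} (hi : i < n + 3) :
    dualCoef n (fun x => ∑ k ∈ Finset.range (n + 3), c k * uniformSpline n k x) i = c i := by
  have hw := continuous_dualPiece (i - (i - 3))
  have h : dualCoef n (fun x => ∑ k ∈ Finset.range (n + 3), c k * uniformSpline n k x) i =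
      ∑ k ∈ Finset.range (n + 3), c k * dualCoef n (uniformSpline n k) i := by
    unfold dualCoef
    simp only [Finset.mul_sum]
    rw [intervalIntegral.integral_finsetSum]
    · refine Finset.sum_congr rfl fun k _ => ?_
      rw [← intervalIntegral.integral_const_mul]
      congr 1
      ext s
      ring
    · intro k _
      have := continuous_uniformSpline n k
      exact Continuous.intervalIntegrable (by fun_prop) _ _
  rw [h]
  simp only [dualCoef_uniformSpline hn]
  simp [hi]

theorem quasiInterp_sum {n : ℕ} (hn : 0 < n) (c : ℕ → ℝ) (x : ℝ) :
    quasiInterp n (fun x => ∑ k ∈ Finset.range (n + 3), c k * uniformSpline n k x) x =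
      ∑ k ∈ Finset.range (n + 3), c k * uniformSpline n k x :=
  Finset.sum_congr rfl fun i hi => by rw [dualCoef_sum hn c (Finset.mem_range.1 hi)]

theorem quasiInterp_sub {f g : ℝ → ℝ} (hf : Continuous f) (hg : Continuous g) (n : ℕ) (x : ℝ) :
    quasiInterp n (fun x => f x - g x) x = quasiInterp n f x - quasiInterp n g x := by
  simp only [quasiInterp, dualCoef_sub hf hg, sub_mul, Finset.sum_sub_distrib]

theorem abs_dualCoef_le {n i : ℕ} {f : ℝ → ℝ} {b : ℝ}
    (h : ∀ s ∈ Icc (0 : ℝ) 1, |f ((s + (i - 3 : ℕ)) / n)| ≤ b) : |dualCoef n f i| ≤ 16000 * b := by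
  have := intervalIntegral.norm_integral_le_of_norm_le_const (a := 0) (b := 1) (C := 16000 * b)
    (f := fun s => dualPiece (i - (i - 3)) s * f ((s + (i - 3 : ℕ)) / n)) fun s hs => by
      rw [uIoc_of_le zero_le_one] at hs
      have hs' : s ∈ Icc (0 : ℝ) 1 := ⟨hs.1.le, hs.2⟩
      rw [Real.norm_eq_abs, abs_mul]
      exact mul_le_mul (abs_dualPiece_le hs' _) (h s hs') (abs_nonneg _) (by norm_num)
  simpa [dualCoef] using this

theorem sq_dualCoef_le {f : ℝ → ℝ} (hf : Continuous f) (n i : ℕ) :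
    dualCoef n f i ^ 2 ≤ 16000 ^ 2 * ∫ s in (0 : ℝ)..1, f ((s + (i - 3 : ℕ)) / n) ^ 2 := by
  have hw := continuous_dualPiece (i - (i - 3))
  refine (sq_integral_mul_le hw (by fun_prop)).trans ?_
  exact mul_le_mul_of_nonneg_right (sqInt_le hw fun s hs => abs_dualPiece_le hs _)
    (sqInt_nonneg _)

/-- Serves to show that the B-splines are linearly independent in `L²`: a combination of norm zero
has zero coefficients. -/
theorem sq_dualCoef_le_sqInt {n i : ℕ} (hn : 0 < n) (hi : i < n + 3) {f : ℝ → ℝ}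
    (hf : Continuous f) : dualCoef n f i ^ 2 ≤ 16000 ^ 2 * (n * sqInt f) := by
  refine (sq_dualCoef_le hf n i).trans (mul_le_mul_of_nonneg_left ?_ (by norm_num))
  rw [sqInt, ← sum_integral_cells hn (f := fun x => f x ^ 2) (by fun_prop)]
  exact Finset.single_le_sum (f := fun q : ℕ => ∫ s in (0 : ℝ)..1, f ((s + q) / n) ^ 2)
    (fun q _ => sqInt_nonneg fun s => f ((s + q) / n)) (Finset.mem_range.2 (by omega : i - 3 < n))

/-- The pieces are nonnegative with sum one, so their squares sum to at most one, and Cauchy–Schwarz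
applies. -/
theorem sq_sum_cubicPiece_le (c : ℕ → ℝ) {s : ℝ} (hs : s ∈ Icc (0 : ℝ) 1) :
    (∑ l ∈ Finset.range 4, c l * cubicPiece l s) ^ 2 ≤ ∑ l ∈ Finset.range 4, c l ^ 2 := by
  have hp := cubicPiece_nonneg hs.1 hs.2
  have h1 : ∀ l ∈ Finset.range 4, cubicPiece l s ≤ 1 := fun l hl => by
    rw [← sum_cubicPiece s]
    exact Finset.single_le_sum (fun l _ => hp l) hl
  refine (Finset.sum_mul_sq_le_sq_mul_sq _ _ _).trans ?_
  refine mul_le_of_le_one_right (Finset.sum_nonneg fun _ _ => sq_nonneg _) ?_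
  rw [← sum_cubicPiece s]
  exact Finset.sum_le_sum fun l hl => by nlinarith [hp l, h1 l hl]

/-- The quasi-interpolation is bounded on `L²[0, 1]`, uniformly in the number of cells. -/
theorem sqInt_quasiInterp_le {n : ℕ} (hn : 0 < n) {f : ℝ → ℝ} (hf : Continuous f) :
    sqInt (quasiInterp n f) ≤ 16 * 16000 ^ 2 * sqInt f := by
  have h0 : (0 : ℝ) < n := by exact_mod_cast hn
  have hQ := continuous_quasiInterp n f
  set c := dualCoef n f with hc
  set a : ℕ → ℝ := fun q => ∫ s in (0 : ℝ)..1, f ((s + q) / n) ^ 2 with ha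
  have ha0 : ∀ q, 0 ≤ a q := fun q => sqInt_nonneg fun s => f ((s + q) / n)
  have hsum : ∑ q ∈ Finset.range n, a q = n * sqInt f :=
    sum_integral_cells hn (f := fun x => f x ^ 2) (by fun_prop)
  have e1 : n * sqInt (quasiInterp n f) ≤
      ∑ q ∈ Finset.range n, ∑ l ∈ Finset.range 4, c (q + l) ^ 2 := by
    rw [sqInt, ← sum_integral_cells hn (f := fun x => quasiInterp n f x ^ 2) (by fun_prop)]
    refine Finset.sum_le_sum fun q hq => ?_
    refine (intervalIntegral.integral_mono_on zero_le_one
      (Continuous.intervalIntegrable (by fun_prop) _ _)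
      (g := fun _ => ∑ l ∈ Finset.range 4, c (q + l) ^ 2)
      (Continuous.intervalIntegrable (by fun_prop) _ _) fun s hs => ?_).trans (by simp)
    rw [quasiInterp, sum_uniformSpline_cell (Finset.mem_range.1 hq) _ hs]
    exact sq_sum_cubicPiece_le (fun l => c (q + l)) hs
  -- Each coefficient acts on at most four cells.
  have e2 : ∑ q ∈ Finset.range n, ∑ l ∈ Finset.range 4, c (q + l) ^ 2 ≤
      4 * ∑ i ∈ Finset.range (n + 3), c i ^ 2 := by
    rw [Finset.sum_comm]
    have : ∀ l ∈ Finset.range 4, ∑ q ∈ Finset.range n, c (q + l) ^ 2 ≤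
        ∑ i ∈ Finset.range (n + 3), c i ^ 2 := by
      intro l hl
      have hl' := Finset.mem_range.1 hl
      obtain ⟨d, hd⟩ : ∃ d, n + 3 = l + n + d := ⟨3 - l, by omega⟩
      rw [hd, Finset.sum_range_add, Finset.sum_range_add]
      have h1 : 0 ≤ ∑ x ∈ Finset.range l, c x ^ 2 := Finset.sum_nonneg fun _ _ => sq_nonneg _
      have h2 : 0 ≤ ∑ x ∈ Finset.range d, c (l + n + x) ^ 2 :=
        Finset.sum_nonneg fun _ _ => sq_nonneg _
      simp only [add_comm _ l]
      linarith
    refine (Finset.sum_le_sum this).trans ?_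
    simp
  -- The cell `0` carries the four functionals `0, …, 3` and every other cell carries one, whence
  -- the second factor `4`.
  have e3 : ∑ i ∈ Finset.range (n + 3), c i ^ 2 ≤ 16000 ^ 2 * (4 * (n * sqInt f)) := by
    have h1 : ∀ i ∈ Finset.range (n + 3), c i ^ 2 ≤ 16000 ^ 2 * a (i - 3) := fun i _ =>
      sq_dualCoef_le hf n i
    refine (Finset.sum_le_sum h1).trans ?_
    rw [← Finset.mul_sum, add_comm n 3, Finset.sum_range_add, ← hsum]
    have h2 : a 0 ≤ ∑ q ∈ Finset.range n, a q :=
      Finset.single_le_sum (fun q _ => ha0 q) (Finset.mem_range.2 hn)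
    refine mul_le_mul_of_nonneg_left ?_ (by norm_num)
    simp only [Finset.sum_range_succ, Finset.sum_range_zero, Nat.add_sub_cancel_left]
    norm_num
    linarith
  have : n * sqInt (quasiInterp n f) ≤ n * (16 * 16000 ^ 2 * sqInt f) := by linarith
  exact le_of_mul_le_mul_left this h0

/-- The quasi-interpolation is almost optimal in `L²[0, 1]`. -/
theorem sqInt_sub_quasiInterp_le {n : ℕ} (hn : 0 < n) {f : ℝ → ℝ} (hf : Continuous f)
    (c : ℕ → ℝ) :
    sqInt (fun x => quasiInterp n f x - f x) ≤ (2 + 32 * 16000 ^ 2) *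
      sqInt (fun x => f x - ∑ k ∈ Finset.range (n + 3), c k * uniformSpline n k x) := by
  set v : ℝ → ℝ := fun x => ∑ k ∈ Finset.range (n + 3), c k * uniformSpline n k x with hv
  have hvc : Continuous v :=
    continuous_finsetSum _ fun i _ => (continuous_uniformSpline n i).const_mul _
  -- A projection fixes `v`, so the error for `f` is the error for `f - v`.
  have h1 : ∀ x, quasiInterp n f x - f x =
      quasiInterp n (fun x => f x - v x) x + -1 * (f x - v x) := by
    intro x
    rw [quasiInterp_sub hf hvc, hv, quasiInterp_sum hn]
    ring
  simp only [h1]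
  refine (sqInt_add_le (continuous_quasiInterp _ _) (by fun_prop)).trans ?_
  have := sqInt_quasiInterp_le hn (f := fun x => f x - v x) (by fun_prop)
  rw [sqInt_const_mul]
  linarith

/-- Functions that are locally cubic up to fourth order are approximated to fourth order. -/
theorem abs_quasiInterp_sub_le {n : ℕ} (hn : 0 < n) {f : ℝ → ℝ} (hf : Continuous f) {C : ℝ}
    (hC : 0 ≤ C)
    (h : ∀ x ∈ Icc (0 : ℝ) 1, ∃ a : ℕ → ℝ, ∀ y ∈ Icc (0 : ℝ) 1,
      |f y - ∑ j ∈ Finset.range 4, a j * y ^ j| ≤ C * |y - x| ^ 4)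
    {x : ℝ} (hx : x ∈ Icc (0 : ℝ) 1) :
    |quasiInterp n f x - f x| ≤ 16000 * (C * 256) / n ^ 4 := by
  have h0 : (0 : ℝ) < n := by exact_mod_cast hn
  -- The cubic is adapted to the point `x`. It is itself a spline `v` with `v x = f x`, so the error
  -- at `x` equals the quasi-interpolant of `f - v` at `x`.
  obtain ⟨a, ha⟩ := h x hx
  obtain ⟨c, hc⟩ := exists_spline_eq_cubic hn a
  set v : ℝ → ℝ := fun x => ∑ k ∈ Finset.range (n + 3), c k * uniformSpline n k x with hv
  have hvc : Continuous v :=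
    continuous_finsetSum _ fun i _ => (continuous_uniformSpline n i).const_mul _
  have hfv : ∀ y ∈ Icc (0 : ℝ) 1, |f y - v y| ≤ C * |y - x| ^ 4 := fun y hy => by
    simpa only [hv, hc y hy] using ha y hy
  have hfx : f x = v x := by
    have := hfv x hx
    simp only [sub_self, abs_zero] at this
    have h2 := abs_nonneg (f x - v x)
    have : |f x - v x| = 0 := le_antisymm (by simpa using this) h2
    linarith [abs_eq_zero.1 this]
  have h1 : quasiInterp n f x - f x = quasiInterp n (fun x => f x - v x) x := by
    rw [quasiInterp_sub hf hvc, hfx, hv, quasiInterp_sum hn]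
  obtain ⟨q, hq, s, hs, rfl⟩ := exists_cell hn hx
  rw [h1, quasiInterp, sum_uniformSpline_cell hq _ hs]
  -- The functionals `q, …, q + 3` live on cells from `q - 3` to `q`, within distance `4 / n` of
  -- `x`; hence `256 = 4 ^ 4`.
  have hcoef : ∀ l ∈ Finset.range 4, |dualCoef n (fun x => f x - v x) (q + l) * cubicPiece l s| ≤
      16000 * (C * (4 / n) ^ 4) * cubicPiece l s := by
    intro l hl
    have hl' := Finset.mem_range.1 hl
    rw [abs_mul, abs_of_nonneg (cubicPiece_nonneg hs.1 hs.2 l)]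
    refine mul_le_mul_of_nonneg_right (abs_dualCoef_le fun t ht => ?_)
      (cubicPiece_nonneg hs.1 hs.2 l)
    refine (hfv _ (cell_mem (by omega) ht)).trans ?_
    refine mul_le_mul_of_nonneg_left (pow_le_pow_left₀ (abs_nonneg _) ?_ 4) hC
    rw [div_sub_div_same, abs_div, abs_of_pos h0]
    refine div_le_div_of_nonneg_right ?_ h0.le
    have b1 : ((q + l - 3 : ℕ) : ℝ) ≤ q := by exact_mod_cast (by omega : q + l - 3 ≤ q)
    have b2 : (q : ℝ) ≤ ((q + l - 3 : ℕ) : ℝ) + 3 := by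
      exact_mod_cast (by omega : q ≤ q + l - 3 + 3)
    rw [abs_le]
    constructor <;> linarith [hs.1, hs.2, ht.1, ht.2]
  refine (Finset.abs_sum_le_sum_abs _ _).trans ((Finset.sum_le_sum hcoef).trans ?_)
  rw [← Finset.mul_sum, sum_cubicPiece, mul_one, div_pow]
  apply le_of_eq
  ring

/-- Taylor expansion of third order, around any point of the interval. -/
theorem exists_cubic_approx {f : ℝ → ℝ} (hf : ContDiffOn ℝ 4 f (Icc 0 1)) {C : ℝ} (hC : 0 ≤ C)
    (hb : ∀ x ∈ Icc (0 : ℝ) 1, |iteratedDerivWithin 4 f (Icc 0 1) x| ≤ C) {x : ℝ}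
    (hx : x ∈ Icc (0 : ℝ) 1) :
    ∃ a : ℕ → ℝ, ∀ y ∈ Icc (0 : ℝ) 1,
      |f y - ∑ j ∈ Finset.range 4, a j * y ^ j| ≤ C * |y - x| ^ 4 := by
  set D : ℕ → ℝ := fun j => iteratedDerivWithin j f (Icc 0 1) x with hD
  -- The Taylor polynomial at `x`, rearranged in powers of `y`.
  let a : ℕ → ℝ := fun j => match j with
    | 0 => D 0 - D 1 * x + D 2 / 2 * x ^ 2 - D 3 / 6 * x ^ 3
    | 1 => D 1 - D 2 * x + D 3 / 2 * x ^ 2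
    | 2 => D 2 / 2 - D 3 / 2 * x
    | 3 => D 3 / 6
    | _ + 4 => 0
  have hfx : D 0 = f x := by simp [hD]
  refine ⟨a, fun y hy => ?_⟩
  have hsum : ∑ j ∈ Finset.range 4, a j * y ^ j =
      D 0 + D 1 * (y - x) + D 2 / 2 * (y - x) ^ 2 + D 3 / 6 * (y - x) ^ 3 := by
    simp only [Finset.sum_range_succ, Finset.sum_range_zero, a]
    ring
  rw [hsum]
  rcases eq_or_ne x y with rfl | hxy
  · simp [hfx]
  have hsub : uIcc x y ⊆ Icc 0 1 := uIcc_subset_Icc hx hy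
  have hud : UniqueDiffOn ℝ (uIcc x y) := uniqueDiffOn_uIcc hxy
  have hud1 : UniqueDiffOn ℝ (Icc (0 : ℝ) 1) := uniqueDiffOn_Icc zero_lt_one
  -- Taylor's theorem is applied on the interval between `x` and `y`; derivatives within it agree
  -- with those within `[0, 1]`, up to its endpoints.
  have hiter : ∀ j : ℕ, j ≤ 4 → ∀ t ∈ uIcc x y,
      iteratedDerivWithin j f (uIcc x y) t = iteratedDerivWithin j f (Icc 0 1) t := by
    intro j hj t ht
    rw [iteratedDerivWithin, iteratedDerivWithin,
      iteratedFDerivWithin_subset hsub hud hud1 (hf.of_le (by exact_mod_cast hj)) ht]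
  obtain ⟨t, ht, h⟩ := taylor_mean_remainder_lagrange (n := 3) hxy
    ((hf.mono hsub).of_le (by norm_num))
    (((hf.mono hsub).differentiableOn_iteratedDerivWithin (by norm_num) hud).mono
      uIoo_subset_uIcc_self)
  have ht' := uIoo_subset_uIcc_self ht
  rw [taylor_within_apply] at h
  simp only [Finset.sum_range_succ, Finset.sum_range_zero, smul_eq_mul] at h
  rw [hiter 0 (by norm_num) x left_mem_uIcc, hiter 1 (by norm_num) x left_mem_uIcc,
    hiter 2 (by norm_num) x left_mem_uIcc, hiter 3 (by norm_num) x left_mem_uIcc,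
    hiter 4 (by norm_num) t ht'] at h
  have h' : f y - (D 0 + D 1 * (y - x) + D 2 / 2 * (y - x) ^ 2 + D 3 / 6 * (y - x) ^ 3) =
      iteratedDerivWithin 4 f (Icc 0 1) t * (y - x) ^ 4 / 24 := by
    rw [show (24 : ℝ) = ((3 + 1).factorial : ℕ) by norm_num [Nat.factorial], ← h]
    simp only [hD, Nat.factorial]
    norm_num
    ring
  rw [h', abs_div, abs_mul, abs_pow]
  have := hb t (hsub ht')
  have h4 : 0 ≤ |y - x| ^ 4 := by positivity
  rw [div_le_iff₀ (by norm_num)]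
  norm_num
  nlinarith [mul_le_mul_of_nonneg_right this h4, mul_nonneg hC h4]

/-! ### The inverse square root of a symmetric matrix -/

section InvSqrt

variable {ι : Type*} [Fintype ι] [DecidableEq ι] {A : Matrix ι ι ℝ}

theorem cfc_eq_mul_diagonal_mul (hA : A.IsHermitian) (f : ℝ → ℝ) :
    hA.cfc f = (hA.eigenvectorUnitary : Matrix ι ι ℝ) *
      Matrix.diagonal (fun i => f (hA.eigenvalues i)) *
        (hA.eigenvectorUnitary : Matrix ι ι ℝ)ᵀ := by
  rw [Matrix.IsHermitian.cfc, Unitary.conjStarAlgAut_apply, Matrix.star_eq_conjTranspose,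
    Matrix.conjTranspose_eq_transpose_of_trivial]
  rfl

theorem eigenvectorUnitary_transpose_mul (hA : A.IsHermitian) :
    (hA.eigenvectorUnitary : Matrix ι ι ℝ)ᵀ * (hA.eigenvectorUnitary : Matrix ι ι ℝ) = 1 := by
  have := Unitary.coe_star_mul_self hA.eigenvectorUnitary
  rwa [Matrix.star_eq_conjTranspose, Matrix.conjTranspose_eq_transpose_of_trivial] at this

theorem eigenvectorUnitary_mul_transpose (hA : A.IsHermitian) :
    (hA.eigenvectorUnitary : Matrix ι ι ℝ) * (hA.eigenvectorUnitary : Matrix ι ι ℝ)ᵀ = 1 :=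
  mul_eq_one_comm.1 (eigenvectorUnitary_transpose_mul hA)

theorem eq_mul_diagonal_mul (hA : A.IsHermitian) :
    A = (hA.eigenvectorUnitary : Matrix ι ι ℝ) * Matrix.diagonal hA.eigenvalues *
      (hA.eigenvectorUnitary : Matrix ι ι ℝ)ᵀ := by
  conv_lhs => rw [hA.spectral_theorem, Unitary.conjStarAlgAut_apply,
    Matrix.star_eq_conjTranspose, Matrix.conjTranspose_eq_transpose_of_trivial]
  rfl

theorem transpose_cfc (hA : A.IsHermitian) (f : ℝ → ℝ) : (hA.cfc f)ᵀ = hA.cfc f := by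
  rw [cfc_eq_mul_diagonal_mul, Matrix.transpose_mul, Matrix.transpose_mul,
    Matrix.transpose_transpose, Matrix.diagonal_transpose, Matrix.mul_assoc]

theorem invSqrt_mul_mul_invSqrt (hA : A.IsHermitian) (hpos : ∀ i, 0 < hA.eigenvalues i) :
    hA.cfc (fun x => (Real.sqrt x)⁻¹) * A * hA.cfc (fun x => (Real.sqrt x)⁻¹) = 1 := by
  set U : Matrix ι ι ℝ := hA.eigenvectorUnitary.val with hU
  set D := Matrix.diagonal fun i => (Real.sqrt (hA.eigenvalues i))⁻¹ with hD
  have hUU : Uᵀ * U = 1 := eigenvectorUnitary_transpose_mul hA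
  have hDD : D * Matrix.diagonal hA.eigenvalues * D = 1 := by
    rw [hD, Matrix.diagonal_mul_diagonal, Matrix.diagonal_mul_diagonal, ← Matrix.diagonal_one]
    congr 1
    ext i
    have h := Real.mul_self_sqrt (hpos i).le
    have h' := (Real.sqrt_pos.2 (hpos i)).ne'
    field_simp
    nlinarith
  have hR : hA.cfc (fun x => (Real.sqrt x)⁻¹) = U * D * Uᵀ := cfc_eq_mul_diagonal_mul hA _
  have hA' : A = U * Matrix.diagonal hA.eigenvalues * Uᵀ := eq_mul_diagonal_mul hA
  calc hA.cfc (fun x => (Real.sqrt x)⁻¹) * A * hA.cfc (fun x => (Real.sqrt x)⁻¹)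
      = (U * D * Uᵀ) * (U * Matrix.diagonal hA.eigenvalues * Uᵀ) * (U * D * Uᵀ) := by
        rw [hR, ← hA']
    _ = U * D * (Uᵀ * U) * Matrix.diagonal hA.eigenvalues * (Uᵀ * U) * D * Uᵀ := by
        simp only [Matrix.mul_assoc]
    _ = U * (D * Matrix.diagonal hA.eigenvalues * D) * Uᵀ := by
        simp only [hUU, Matrix.mul_one, Matrix.mul_assoc]
    _ = 1 := by
        rw [hDD, Matrix.mul_one]
        exact eigenvectorUnitary_mul_transpose hA

theorem sum_sq_eigenvectorUnitary_row (hA : A.IsHermitian) (i : ι) :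
    ∑ k, (hA.eigenvectorUnitary : Matrix ι ι ℝ) i k ^ 2 = 1 := by
  have := congrFun (congrFun (eigenvectorUnitary_mul_transpose hA) i) i
  rw [Matrix.mul_apply, Matrix.one_apply_eq] at this
  rw [← this]
  exact Finset.sum_congr rfl fun k _ => by rw [Matrix.transpose_apply, sq]

theorem sum_sq_eigenvectorUnitary_col (hA : A.IsHermitian) (k : ι) :
    ∑ i, (hA.eigenvectorUnitary : Matrix ι ι ℝ) i k ^ 2 = 1 := by
  have := congrFun (congrFun (eigenvectorUnitary_transpose_mul hA) k) k
  rw [Matrix.mul_apply, Matrix.one_apply_eq] at this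
  rw [← this]
  exact Finset.sum_congr rfl fun k _ => by rw [Matrix.transpose_apply, sq]

/-- An eigenvalue minus one is the quadratic form of `A - 1` at a unit eigenvector; the products of
its coordinates are split by `2 |x y| ≤ x² + y²`. -/
theorem abs_eigenvalues_sub_one_le (hA : A.IsHermitian) {η : ℝ}
    (hη : ∀ i j, |A i j - (1 : Matrix ι ι ℝ) i j| ≤ η) (k : ι) :
    |hA.eigenvalues k - 1| ≤ Fintype.card ι * η := by
  set U : Matrix ι ι ℝ := hA.eigenvectorUnitary.val with hU
  have hUU : Uᵀ * U = 1 := eigenvectorUnitary_transpose_mul hA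
  have hA' : A = U * Matrix.diagonal hA.eigenvalues * Uᵀ := eq_mul_diagonal_mul hA
  have h1 : Matrix.diagonal hA.eigenvalues - 1 = Uᵀ * (A - 1) * U := by
    calc Matrix.diagonal hA.eigenvalues - 1
        = (Uᵀ * U) * Matrix.diagonal hA.eigenvalues * (Uᵀ * U) - Uᵀ * U := by
          simp only [hUU, Matrix.one_mul, Matrix.mul_one]
      _ = Uᵀ * (U * Matrix.diagonal hA.eigenvalues * Uᵀ) * U - Uᵀ * U := by
          simp only [Matrix.mul_assoc]
      _ = _ := by
          rw [← hA', Matrix.mul_sub, Matrix.mul_one, Matrix.sub_mul]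
  have h2 : hA.eigenvalues k - 1 = ∑ j, ∑ i, U i k * (A i j - (1 : Matrix ι ι ℝ) i j) * U j k := by
    have := congrFun (congrFun h1 k) k
    rw [Matrix.sub_apply, Matrix.diagonal_apply_eq, Matrix.one_apply_eq, Matrix.mul_apply] at this
    rw [this]
    refine Finset.sum_congr rfl fun j _ => ?_
    rw [Matrix.mul_apply, Finset.sum_mul]
    exact Finset.sum_congr rfl fun i _ => by rw [Matrix.transpose_apply, Matrix.sub_apply]
  rw [h2]
  have h3 : ∀ i j, |U i k * (A i j - (1 : Matrix ι ι ℝ) i j) * U j k| ≤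
      η * ((U i k ^ 2 + U j k ^ 2) / 2) := by
    intro i j
    have hη0 : 0 ≤ η := (abs_nonneg _).trans (hη i j)
    have e : |U i k * (A i j - (1 : Matrix ι ι ℝ) i j) * U j k| =
        |A i j - (1 : Matrix ι ι ℝ) i j| * (|U i k| * |U j k|) := by
      rw [abs_mul, abs_mul]; ring
    rw [e]
    refine mul_le_mul (hη i j) ?_ (by positivity) hη0
    nlinarith [sq_nonneg (|U i k| - |U j k|), sq_abs (U i k), sq_abs (U j k)]
  refine (Finset.abs_sum_le_sum_abs _ _).trans ((Finset.sum_le_sum fun j _ =>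
    (Finset.abs_sum_le_sum_abs _ _).trans (Finset.sum_le_sum fun i _ => h3 i j)).trans ?_)
  apply le_of_eq
  simp only [← Finset.mul_sum, ← Finset.sum_div, Finset.sum_add_distrib, Finset.sum_const,
    sum_sq_eigenvectorUnitary_col, hU, Finset.card_univ, nsmul_eq_mul]
  ring

theorem abs_inv_sqrt_sub_one_le {μ : ℝ} (h : |μ - 1| ≤ 1 / 2) :
    |(Real.sqrt μ)⁻¹ - 1| ≤ 2 * |μ - 1| := by
  have hμ : 1 / 2 ≤ μ := by linarith [(abs_le.1 h).1]
  have hs : 1 / 2 ≤ Real.sqrt μ := Real.le_sqrt_of_sq_le (by linarith)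
  set s := Real.sqrt μ
  have hsq : s ^ 2 = μ := Real.sq_sqrt (by linarith)
  have e : s⁻¹ - 1 = (1 - s) / s := by field_simp
  have hs0 : 0 < s := by linarith
  rw [e, abs_div, abs_of_pos hs0, div_le_iff₀ hs0, ← hsq,
    show s ^ 2 - 1 = -((1 - s) * (1 + s)) by ring, abs_neg, abs_mul, abs_of_pos (a := 1 + s)
    (by linarith)]
  nlinarith [abs_nonneg (1 - s)]

/-- The same eigenvectors diagonalize `A^(-1/2) - 1`, with entries `μ^(-1/2) - 1` of size at most `2
|μ - 1|`, and the rows of the eigenvector matrix are unit vectors. -/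
theorem abs_invSqrt_sub_one_le (hA : A.IsHermitian) {η : ℝ}
    (hη : ∀ i j, |A i j - (1 : Matrix ι ι ℝ) i j| ≤ η) (hc : Fintype.card ι * η ≤ 1 / 2) (i j : ι) :
    |hA.cfc (fun x => (Real.sqrt x)⁻¹) i j - (1 : Matrix ι ι ℝ) i j| ≤
      2 * (Fintype.card ι * η) := by
  set U : Matrix ι ι ℝ := hA.eigenvectorUnitary.val with hU
  have h1 : hA.cfc (fun x => (Real.sqrt x)⁻¹) - 1 =
      U * Matrix.diagonal (fun i => (Real.sqrt (hA.eigenvalues i))⁻¹ - 1) * Uᵀ := by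
    have h := eigenvectorUnitary_mul_transpose hA
    rw [cfc_eq_mul_diagonal_mul, ← Matrix.diagonal_sub, Matrix.mul_sub, Matrix.sub_mul,
      Matrix.diagonal_one, Matrix.mul_one, h]
  rw [← Matrix.sub_apply, h1, Matrix.mul_apply]
  have hη0 : 0 ≤ Fintype.card ι * η := by
    have := (abs_nonneg _).trans (hη i j)
    positivity
  have h3 : ∀ k, |(U * Matrix.diagonal (fun i => (Real.sqrt (hA.eigenvalues i))⁻¹ - 1)) i k *
      Uᵀ k j| ≤ 2 * (Fintype.card ι * η) * ((U i k ^ 2 + U j k ^ 2) / 2) := by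
    intro k
    rw [Matrix.mul_diagonal, Matrix.transpose_apply]
    have hk := abs_eigenvalues_sub_one_le hA hη k
    have hf := abs_inv_sqrt_sub_one_le (hk.trans hc)
    have e : |U i k * ((Real.sqrt (hA.eigenvalues k))⁻¹ - 1) * U j k| =
        |(Real.sqrt (hA.eigenvalues k))⁻¹ - 1| * (|U i k| * |U j k|) := by
      rw [abs_mul, abs_mul]; ring
    rw [e]
    refine mul_le_mul (by linarith) ?_ (by positivity) (by linarith)
    nlinarith [sq_nonneg (|U i k| - |U j k|), sq_abs (U i k), sq_abs (U j k)]
  refine (Finset.abs_sum_le_sum_abs _ _).trans ((Finset.sum_le_sum fun k _ => h3 k).trans ?_)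
  apply le_of_eq
  simp only [← Finset.mul_sum, ← Finset.sum_div, Finset.sum_add_distrib,
    sum_sq_eigenvectorUnitary_row, hU]
  ring

end InvSqrt

/-! ### Orthonormalization of the spline basis -/

theorem integral_sum_mul_sum {ι κ : Type*} (s : Finset ι) (t : Finset κ) {f : ι → ℝ → ℝ}
    {g : κ → ℝ → ℝ} (hf : ∀ i, Continuous (f i)) (hg : ∀ j, Continuous (g j)) (a : ι → ℝ)
    (b : κ → ℝ) :
    ∫ x in (0 : ℝ)..1, (∑ i ∈ s, a i * f i x) * (∑ j ∈ t, b j * g j x) =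
      ∑ i ∈ s, ∑ j ∈ t, a i * b j * ∫ x in (0 : ℝ)..1, f i x * g j x := by
  simp only [Finset.sum_mul_sum]
  rw [intervalIntegral.integral_finsetSum]
  · refine Finset.sum_congr rfl fun i _ => ?_
    rw [intervalIntegral.integral_finsetSum]
    · refine Finset.sum_congr rfl fun j _ => ?_
      rw [← intervalIntegral.integral_const_mul]
      congr 1
      ext x
      ring
    · intro j _
      have := hf i
      have := hg j
      exact Continuous.intervalIntegrable (by fun_prop) _ _
  · intro i _
    have := hf i
    exact Continuous.intervalIntegrable (by fun_prop) _ _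

theorem gram_apply {n : ℕ} (hn : 0 < n) (k l : Fin (n + 3)) :
    gram (n + 3) k l = ∫ x in (0 : ℝ)..1, uniformSpline n k x * uniformSpline n l x := by
  simp only [gram, Matrix.of_apply, cubicSpline_eq hn]

/-- The quadratic form of the Gram matrix is the squared norm of a spline, and the dual functionals
recover the coefficients from the spline. Positivity excludes the default values of `Real.sqrt` and
the inverse in `gramInvSqrt`. -/
theorem gram_eigenvalues_pos {n : ℕ} (hn : 0 < n) (i : Fin (n + 3)) :
    0 < (gram_isHermitian (n + 3)).eigenvalues i := by
  have hpd : (gram (n + 3)).PosDef := by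
    refine Matrix.PosDef.of_dotProduct_mulVec_pos (gram_isHermitian _) fun y hy => ?_
    let c : ℕ → ℝ := fun j => if h : j < n + 3 then y ⟨j, h⟩ else 0
    have hcy : ∀ j : Fin (n + 3), c j = y j := fun j => by simp [c]
    set v : ℝ → ℝ := fun x => ∑ k ∈ Finset.range (n + 3), c k * uniformSpline n k x with hv
    have hvc : Continuous v :=
      continuous_finsetSum _ fun i _ => (continuous_uniformSpline n i).const_mul _
    have e : star y ⬝ᵥ gram (n + 3) *ᵥ y = sqInt v := by
      simp only [sqInt, sq, hv, Finset.sum_range, hcy]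
      rw [integral_sum_mul_sum _ _ (fun _ => continuous_uniformSpline _ _)
        (fun _ => continuous_uniformSpline _ _)]
      simp only [dotProduct, Matrix.mulVec, Finset.mul_sum, gram_apply hn]
      refine Finset.sum_congr rfl fun k _ => Finset.sum_congr rfl fun l _ => ?_
      simp only [star_trivial]
      ring
    rw [e]
    refine lt_of_le_of_ne (sqInt_nonneg v) fun h0 => hy ?_
    ext j
    have h1 := sq_dualCoef_le_sqInt hn j.2 hvc
    rw [← h0, hv, dualCoef_sum hn c j.2, hcy] at h1
    simpa using pow_eq_zero_iff (two_ne_zero) |>.1 (le_antisymm (by simpa using h1) (sq_nonneg _))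
  exact hpd.eigenvalues_pos i

theorem gramInvSqrt_mul_gram_mul {n : ℕ} (hn : 0 < n) :
    gramInvSqrt (n + 3) * gram (n + 3) * gramInvSqrt (n + 3) = 1 :=
  invSqrt_mul_mul_invSqrt _ (gram_eigenvalues_pos hn)

theorem psiStar_eq {n r : ℕ} (hn : 0 < n) (B : Matrix (Fin (n + 3)) (Fin r) ℝ) (k : Fin r)
    (x : ℝ) :
    psiStar B k x = ∑ j : Fin (n + 3), (gramInvSqrt (n + 3) * B) j k * uniformSpline n j x := by
  have h : (gramInvSqrt (n + 3))ᵀ = gramInvSqrt (n + 3) := transpose_cfc _ _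
  have e : phi (n + 3) x = (fun j : Fin (n + 3) => uniformSpline n j x) ᵥ* gramInvSqrt (n + 3) := by
    rw [phi, ← Matrix.mulVec_transpose, h]
    congr 1
    ext j
    exact cubicSpline_eq hn j x
  rw [psiStar, e, Matrix.vecMul_vecMul]
  simp only [Matrix.vecMul, dotProduct, mul_comm]

theorem exists_psiStar_eq_sum {n r : ℕ} (hn : 0 < n) (B : Matrix (Fin (n + 3)) (Fin r) ℝ) :
    ∃ c : Fin r → ℕ → ℝ, ∀ k x,
      psiStar B k x = ∑ j ∈ Finset.range (n + 3), c k j * uniformSpline n j x := by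
  refine ⟨fun k j => if h : j < n + 3 then (gramInvSqrt (n + 3) * B) ⟨j, h⟩ k else 0,
    fun k x => ?_⟩
  rw [psiStar_eq hn, Finset.sum_range]
  simp

theorem continuous_psiStar {n r : ℕ} (hn : 0 < n) (B : Matrix (Fin (n + 3)) (Fin r) ℝ)
    (k : Fin r) : Continuous (psiStar B k) := by
  obtain ⟨c, hc⟩ := exists_psiStar_eq_sum hn B
  rw [show psiStar B k = _ from funext (hc k)]
  exact continuous_finsetSum _ fun i _ => (continuous_uniformSpline n i).const_mul _

/-- Orthonormal splines are given by a matrix with orthonormal columns. -/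
theorem exists_matrix_of_orthonormal {n r : ℕ} (hn : 0 < n) (d : Fin r → ℕ → ℝ)
    (h : ∀ k l, ∫ x in (0 : ℝ)..1,
      (∑ j ∈ Finset.range (n + 3), d k j * uniformSpline n j x) *
        (∑ j ∈ Finset.range (n + 3), d l j * uniformSpline n j x) = if k = l then 1 else 0) :
    ∃ B : Matrix (Fin (n + 3)) (Fin r) ℝ, Bᵀ * B = 1 ∧
      ∀ k x, psiStar B k x = ∑ j ∈ Finset.range (n + 3), d k j * uniformSpline n j x := by
  set R := gramInvSqrt (n + 3) with hR
  set G := gram (n + 3) with hG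
  have hRT : Rᵀ = R := transpose_cfc _ _
  have hGT : Gᵀ = G := by
    rw [← Matrix.conjTranspose_eq_transpose_of_trivial]
    exact gram_isHermitian _
  have hRGR : R * G * R = 1 := gramInvSqrt_mul_gram_mul hn
  have hRRG : R * (R * G) = 1 := mul_eq_one_comm.1 hRGR
  let E : Matrix (Fin (n + 3)) (Fin r) ℝ := Matrix.of fun j k => d k j
  -- Since `R * (R * G) = 1`, the matrix `R * G` is the square root of `G`; it converts B-spline
  -- coefficients into coefficients for the orthonormalized basis.
  refine ⟨R * G * E, ?_, fun k x => ?_⟩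
  · have : (R * G * E)ᵀ * (R * G * E) = Eᵀ * G * E := by
      rw [Matrix.transpose_mul, Matrix.transpose_mul, hRT, hGT]
      calc Eᵀ * (G * R) * (R * G * E) = Eᵀ * G * (R * (R * G)) * E := by
            simp only [Matrix.mul_assoc]
        _ = Eᵀ * G * E := by rw [hRRG, Matrix.mul_one]
    rw [this]
    ext k l
    rw [Matrix.one_apply, ← h k l]
    simp only [Finset.sum_range]
    rw [integral_sum_mul_sum _ _ (fun _ => continuous_uniformSpline _ _)
      (fun _ => continuous_uniformSpline _ _), Finset.sum_comm]
    simp only [Matrix.mul_apply, Matrix.transpose_apply, E, Matrix.of_apply, Finset.sum_mul, hG,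
      gram_apply hn]
    refine Finset.sum_congr rfl fun i _ => Finset.sum_congr rfl fun j _ => ?_
    ring
  · rw [psiStar_eq hn, ← Matrix.mul_assoc, hRRG, Matrix.one_mul, Finset.sum_range]
    rfl

/-! ### Kernels of finite rank -/

/-- The kernel `∑ a k * f k u * f k v`. -/
noncomputable def finiteKernel {r : ℕ} (a : Fin r → ℝ) (f : Fin r → ℝ → ℝ) (u v : ℝ) : ℝ :=
  ∑ k, a k * f k u * f k v

theorem continuous_finiteKernel {r : ℕ} (a : Fin r → ℝ) {f : Fin r → ℝ → ℝ}
    (hf : ∀ k, Continuous (f k)) : Continuous (Function.uncurry (finiteKernel a f)) := by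
  unfold Function.uncurry finiteKernel
  refine continuous_finsetSum _ fun k _ => ?_
  have := hf k
  fun_prop

theorem hsNorm_sq {D : ℝ → ℝ → ℝ} :
    hsNorm D ^ 2 = ∫ u in (0 : ℝ)..1, ∫ v in (0 : ℝ)..1, D u v ^ 2 :=
  Real.sq_sqrt (intervalIntegral.integral_nonneg zero_le_one fun _ _ => sqInt_nonneg _)

theorem hsNorm_nonneg (D : ℝ → ℝ → ℝ) : 0 ≤ hsNorm D := Real.sqrt_nonneg _

theorem hsNorm_congr {D E : ℝ → ℝ → ℝ}
    (h : ∀ u ∈ Icc (0 : ℝ) 1, ∀ v ∈ Icc (0 : ℝ) 1, D u v = E u v) : hsNorm D = hsNorm E := by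
  unfold hsNorm
  congr 1
  refine intervalIntegral.integral_congr fun u hu => ?_
  rw [uIcc_of_le zero_le_one] at hu
  exact sqInt_congr (h u hu)

theorem continuous_integral_right {D : ℝ → ℝ → ℝ} (hD : Continuous (Function.uncurry D)) :
    Continuous fun u => ∫ v in (0 : ℝ)..1, D u v :=
  intervalIntegral.continuous_parametric_intervalIntegral_of_continuous' hD 0 1

/-- An integral operator is bounded by the Hilbert–Schmidt norm of its kernel. -/
theorem sqInt_integral_le {D : ℝ → ℝ → ℝ} (hD : Continuous (Function.uncurry D)) {f : ℝ → ℝ}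
    (hf : Continuous f) :
    sqInt (fun u => ∫ v in (0 : ℝ)..1, D u v * f v) ≤ hsNorm D ^ 2 * sqInt f := by
  have hDu : ∀ u, Continuous (D u) := fun u => hD.comp (by fun_prop : Continuous fun v => (u, v))
  rw [hsNorm_sq, ← intervalIntegral.integral_mul_const]
  refine intervalIntegral.integral_mono_on zero_le_one ?_ ?_ fun u _ =>
    sq_integral_mul_le (hDu u) hf
  · have : Continuous fun u => ∫ v in (0 : ℝ)..1, D u v * f v :=
      continuous_integral_right (D := fun u v => D u v * f v)
        (hD.mul (hf.comp continuous_snd))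
    exact (this.pow 2).intervalIntegrable _ _
  · have : Continuous fun u => ∫ v in (0 : ℝ)..1, D u v ^ 2 :=
      continuous_integral_right (D := fun u v => D u v ^ 2) (hD.pow 2)
    exact (this.mul continuous_const).intervalIntegrable _ _

theorem integral_finiteKernel_mul {r : ℕ} (a : Fin r → ℝ) {f : Fin r → ℝ → ℝ}
    (hf : ∀ k, Continuous (f k)) {g : ℝ → ℝ} (hg : Continuous g) (u : ℝ) :
    ∫ v in (0 : ℝ)..1, finiteKernel a f u v * g v =
      ∑ k, a k * (∫ v in (0 : ℝ)..1, f k v * g v) * f k u := by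
  simp only [finiteKernel, Finset.sum_mul]
  rw [intervalIntegral.integral_finsetSum]
  · refine Finset.sum_congr rfl fun k _ => ?_
    rw [mul_right_comm, ← intervalIntegral.integral_const_mul]
    congr 1
    ext v
    ring
  · intro k _
    have := hf k
    exact Continuous.intervalIntegrable (by fun_prop) _ _

/-- Up to sign each term is `f ⊗ (g - f) + (g - f) ⊗ g`, and one factor of each product has norm
one. Cauchy–Schwarz over the terms and the sum over `k` give `r²`; the two products give `4`. -/
theorem hsNorm_sq_finiteKernel_sub_le {r : ℕ} {a : Fin r → ℝ} {f g : Fin r → ℝ → ℝ}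
    (hf : ∀ k, Continuous (f k)) (hg : ∀ k, Continuous (g k)) (hf1 : ∀ k, sqInt (f k) = 1)
    (hg1 : ∀ k, sqInt (g k) = 1) {b ε : ℝ} (hab : ∀ k, |a k| ≤ b)
    (hε : ∀ k, sqInt (fun x => g k x - f k x) ≤ ε) :
    hsNorm (finiteKernel a f - finiteKernel a g) ^ 2 ≤ 4 * r ^ 2 * b ^ 2 * ε := by
  have hpt : ∀ u v, (finiteKernel a f - finiteKernel a g) u v ^ 2 ≤
      ∑ k, 2 * r * b ^ 2 * (f k u ^ 2 * (g k v - f k v) ^ 2 +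
        (g k u - f k u) ^ 2 * g k v ^ 2) := by
    intro u v
    have e : (finiteKernel a f - finiteKernel a g) u v =
        ∑ k, -a k * (f k u * (g k v - f k v) + (g k u - f k u) * g k v) := by
      simp only [Pi.sub_apply, finiteKernel, ← Finset.sum_sub_distrib]
      exact Finset.sum_congr rfl fun k _ => by ring
    rw [e]
    refine sq_sum_le_card_mul_sum_sq.trans ?_
    rw [Finset.mul_sum, Finset.card_univ, Fintype.card_fin]
    refine Finset.sum_le_sum fun k _ => ?_
    have ha : a k ^ 2 ≤ b ^ 2 :=
      sq_le_sq' (by linarith [(abs_le.1 (hab k)).1]) (abs_le.1 (hab k)).2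
    rw [mul_pow, neg_sq]
    calc (r : ℝ) * (a k ^ 2 * (f k u * (g k v - f k v) + (g k u - f k u) * g k v) ^ 2)
        ≤ r * (b ^ 2 * (2 * (f k u ^ 2 * (g k v - f k v) ^ 2 +
          (g k u - f k u) ^ 2 * g k v ^ 2))) := by
          refine mul_le_mul_of_nonneg_left (mul_le_mul ha ?_ (sq_nonneg _) (sq_nonneg _))
            (by positivity)
          nlinarith [sq_nonneg (f k u * (g k v - f k v) - (g k u - f k u) * g k v)]
      _ = _ := by ring
  have hDc : Continuous (Function.uncurry (finiteKernel a f - finiteKernel a g)) :=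
    (continuous_finiteKernel a hf).sub (continuous_finiteKernel a hg)
  have hin : ∀ u, ∫ v in (0 : ℝ)..1, (finiteKernel a f - finiteKernel a g) u v ^ 2 ≤
      ∑ k, 2 * r * b ^ 2 * (f k u ^ 2 * ε + (g k u - f k u) ^ 2) := by
    intro u
    have hDu : Continuous ((finiteKernel a f - finiteKernel a g) u) :=
      hDc.comp (by fun_prop : Continuous fun v => (u, v))
    refine (intervalIntegral.integral_mono_on zero_le_one
      (Continuous.intervalIntegrable (by fun_prop) _ _)
      (Continuous.intervalIntegrable (by fun_prop) _ _) fun v _ => hpt u v).trans ?_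
    rw [intervalIntegral.integral_finsetSum
      fun k _ => Continuous.intervalIntegrable (by fun_prop) _ _]
    refine Finset.sum_le_sum fun k _ => ?_
    rw [intervalIntegral.integral_const_mul, intervalIntegral.integral_add
      (Continuous.intervalIntegrable (by fun_prop) _ _)
      (Continuous.intervalIntegrable (by fun_prop) _ _), intervalIntegral.integral_const_mul,
      intervalIntegral.integral_const_mul]
    refine mul_le_mul_of_nonneg_left (add_le_add
      (mul_le_mul_of_nonneg_left (hε k) (sq_nonneg _)) ?_) (by positivity)
    have := hg1 k
    rw [sqInt] at this
    rw [this, mul_one]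
  rw [hsNorm_sq]
  refine (intervalIntegral.integral_mono_on zero_le_one ?_
      (Continuous.intervalIntegrable (by fun_prop) _ _) fun u _ => hin u).trans ?_
  · have : Continuous fun u => ∫ v in (0 : ℝ)..1, (finiteKernel a f - finiteKernel a g) u v ^ 2 :=
      continuous_integral_right
        (D := fun u v => (finiteKernel a f - finiteKernel a g) u v ^ 2) (hDc.pow 2)
    exact this.intervalIntegrable _ _
  rw [intervalIntegral.integral_finsetSum
      fun k _ => Continuous.intervalIntegrable (by fun_prop) _ _]
  have hk : ∀ k, ∫ u in (0 : ℝ)..1, 2 * r * b ^ 2 * (f k u ^ 2 * ε + (g k u - f k u) ^ 2) ≤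
      2 * r * b ^ 2 * (ε + ε) := by
    intro k
    rw [intervalIntegral.integral_const_mul, intervalIntegral.integral_add
      (Continuous.intervalIntegrable (by fun_prop) _ _)
      (Continuous.intervalIntegrable (by fun_prop) _ _), intervalIntegral.integral_mul_const]
    refine mul_le_mul_of_nonneg_left (add_le_add ?_ (hε k)) (by positivity)
    have := hf1 k
    rw [sqInt] at this
    rw [this, one_mul]
  refine (Finset.sum_le_sum fun k _ => hk k).trans (le_of_eq ?_)
  simp
  ring

theorem abs_finiteKernel_sub_le {r : ℕ} {a : Fin r → ℝ} {f g : Fin r → ℝ → ℝ} {b c τ : ℝ}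
    (hab : ∀ k, |a k| ≤ b) {u v : ℝ} (hfu : ∀ k, |f k u| ≤ c) (hfv : ∀ k, |f k v| ≤ c)
    (hu : ∀ k, |f k u - g k u| ≤ τ) (hv : ∀ k, |f k v - g k v| ≤ τ) :
    |finiteKernel a f u v - finiteKernel a g u v| ≤ r * (b * (2 * c + τ) * τ) := by
  -- Writing `g` as `f - (f - g)` avoids a separate bound on `g`.
  have e : finiteKernel a f u v - finiteKernel a g u v =
      ∑ k, a k * (f k u * (f k v - g k v) + (f k u - g k u) * (f k v - (f k v - g k v))) := by
    simp only [finiteKernel, ← Finset.sum_sub_distrib]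
    exact Finset.sum_congr rfl fun k _ => by ring
  rw [e]
  have hk : ∀ k, |a k * (f k u * (f k v - g k v) +
      (f k u - g k u) * (f k v - (f k v - g k v)))| ≤ b * (2 * c + τ) * τ := by
    intro k
    have hb0 : 0 ≤ b := (abs_nonneg _).trans (hab k)
    have hτ0 : 0 ≤ τ := (abs_nonneg _).trans (hu k)
    have hc0 : 0 ≤ c := (abs_nonneg _).trans (hfu k)
    rw [abs_mul, mul_assoc]
    refine mul_le_mul (hab k) ?_ (abs_nonneg _) hb0
    have h1 : |f k u * (f k v - g k v)| ≤ c * τ := by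
      rw [abs_mul]
      exact mul_le_mul (hfu k) (hv k) (abs_nonneg _) hc0
    have h2 : |(f k u - g k u) * (f k v - (f k v - g k v))| ≤ τ * (c + τ) := by
      rw [abs_mul]
      exact mul_le_mul (hu k) ((abs_sub _ _).trans (add_le_add (hfv k) (hv k))) (abs_nonneg _) hτ0
    refine (abs_add_le _ _).trans ?_
    linarith
  refine (Finset.abs_sum_le_sum_abs _ _).trans ((Finset.sum_le_sum fun k _ => hk k).trans ?_)
  simp

/-! ### Orthonormal splines near orthonormal functions -/

/-- The symmetric orthonormalization of the quasi-interpolants of orthonormal functions. -/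
theorem exists_orthonormal_splines {n r : ℕ} (hn : 0 < n) {f : Fin r → ℝ → ℝ}
    (hf : ∀ k, Continuous (f k))
    (hort : ∀ k l, ∫ x in (0 : ℝ)..1, f k x * f l x = if k = l then 1 else 0) {ε : ℝ}
    (hε0 : 0 ≤ ε) (hε1 : ε ≤ 1) (hε : ∀ k, sqInt (fun x => quasiInterp n (f k) x - f k x) ≤ ε ^ 2)
    (hrε : r * (3 * ε) ≤ 1 / 2) :
    ∃ B : Matrix (Fin (n + 3)) (Fin r) ℝ, Bᵀ * B = 1 ∧ (∀ k, sqInt (psiStar B k) = 1) ∧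
      ∃ S : Matrix (Fin r) (Fin r) ℝ, (∀ k l, |S k l| ≤ 2 * (r * (3 * ε))) ∧
        ∀ k x, psiStar B k x = quasiInterp n (f k) x + ∑ l, S l k * quasiInterp n (f l) x := by
  have hQ : ∀ k, Continuous (quasiInterp n (f k)) := fun k => continuous_quasiInterp _ _
  let A : Matrix (Fin r) (Fin r) ℝ :=
    Matrix.of fun k l => ∫ x in (0 : ℝ)..1, quasiInterp n (f k) x * quasiInterp n (f l) x
  have hAkl : ∀ k l, A k l =
      ∫ x in (0 : ℝ)..1, quasiInterp n (f k) x * quasiInterp n (f l) x := fun _ _ => rfl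
  have hA : A.IsHermitian := by
    ext k l
    simp [A, mul_comm]
  have hf1 : ∀ k, sqInt (f k) = 1 := fun k => by
    simpa [sqInt, sq] using hort k k
  -- Expanding both factors around `f k` and `f l` leaves three error integrals, each at most `ε`;
  -- the one of second order uses `ε ≤ 1`.
  have hA1 : ∀ k l, |A k l - (1 : Matrix (Fin r) (Fin r) ℝ) k l| ≤ 3 * ε := by
    intro k l
    set p := fun x => quasiInterp n (f k) x - f k x with hp
    set q := fun x => quasiInterp n (f l) x - f l x with hq
    have hpc : Continuous p := (hQ k).sub (hf k)
    have hqc : Continuous q := (hQ l).sub (hf l)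
    have e : A k l - (1 : Matrix (Fin r) (Fin r) ℝ) k l = (∫ x in (0 : ℝ)..1, p x * f l x) +
        (∫ x in (0 : ℝ)..1, f k x * q x) + ∫ x in (0 : ℝ)..1, p x * q x := by
      have := hf k
      have := hf l
      have hi1 : IntervalIntegrable (fun x => quasiInterp n (f k) x * quasiInterp n (f l) x)
        volume 0 1 := ((hQ k).mul (hQ l)).intervalIntegrable _ _
      have hi2 : IntervalIntegrable (fun x => f k x * f l x) volume 0 1 :=
        Continuous.intervalIntegrable (by fun_prop) _ _
      rw [Matrix.one_apply, ← hort k l, ← intervalIntegral.integral_add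
        (Continuous.intervalIntegrable (by fun_prop) _ _)
        (Continuous.intervalIntegrable (by fun_prop) _ _), ← intervalIntegral.integral_add
        (Continuous.intervalIntegrable (by fun_prop) _ _)
        (Continuous.intervalIntegrable (by fun_prop) _ _), hAkl,
        ← intervalIntegral.integral_sub
        hi1 hi2]
      congr 1
      ext x
      simp only [hp, hq]
      ring
    have h1 : |∫ x in (0 : ℝ)..1, p x * f l x| ≤ ε :=
      abs_le_of_sq_le_sq ((sq_integral_mul_le hpc (hf l)).trans (by
        rw [hf1, mul_one]; exact hε k)) hε0
    have h2 : |∫ x in (0 : ℝ)..1, f k x * q x| ≤ ε :=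
      abs_le_of_sq_le_sq ((sq_integral_mul_le (hf k) hqc).trans (by
        rw [hf1, one_mul]; exact hε l)) hε0
    have h3 : |∫ x in (0 : ℝ)..1, p x * q x| ≤ ε :=
      abs_le_of_sq_le_sq ((sq_integral_mul_le hpc hqc).trans (by
        have := mul_le_mul (hε k) (hε l) (sqInt_nonneg _) (sq_nonneg ε)
        nlinarith [sq_nonneg ε, pow_le_one₀ hε0 hε1 (n := 2)])) hε0
    rw [e]
    refine (abs_add_three _ _ _).trans ?_
    linarith
  have hpos : ∀ i, 0 < hA.eigenvalues i := fun i => by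
    have := abs_eigenvalues_sub_one_le hA hA1 i
    rw [Fintype.card_fin] at this
    linarith [(abs_le.1 (this.trans hrε)).1]
  set R := hA.cfc (fun x => (Real.sqrt x)⁻¹) with hR
  have hRAR : R * A * R = 1 := invSqrt_mul_mul_invSqrt hA hpos
  have hRT : Rᵀ = R := transpose_cfc hA _
  -- B-spline coefficients of `∑ R l k * Q (f l)`. The identity `R * A * R = 1` is the
  -- orthonormality of these splines, and `S = R - 1` is small because `A` is close to `1`.
  let d : Fin r → ℕ → ℝ := fun k j => ∑ l, R l k * dualCoef n (f l) j
  have hd : ∀ k x, ∑ j ∈ Finset.range (n + 3), d k j * uniformSpline n j x =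
      ∑ l, R l k * quasiInterp n (f l) x := by
    intro k x
    simp only [d, quasiInterp, Finset.sum_mul, Finset.mul_sum]
    rw [Finset.sum_comm]
    exact Finset.sum_congr rfl fun l _ => Finset.sum_congr rfl fun j _ => by ring
  have hdort : ∀ k l, ∫ x in (0 : ℝ)..1,
      (∑ j ∈ Finset.range (n + 3), d k j * uniformSpline n j x) *
        (∑ j ∈ Finset.range (n + 3), d l j * uniformSpline n j x) = if k = l then 1 else 0 := by
    intro k l
    simp only [hd]
    rw [integral_sum_mul_sum _ _ hQ hQ, ← Matrix.one_apply, ← hRAR, Finset.sum_comm]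
    simp only [Matrix.mul_apply, Finset.sum_mul]
    refine Finset.sum_congr rfl fun i _ => Finset.sum_congr rfl fun j _ => ?_
    have : R j k = R k j := congrFun (congrFun hRT k) j
    rw [this, hAkl]
    ring
  obtain ⟨B, hB, hBd⟩ := exists_matrix_of_orthonormal hn d hdort
  refine ⟨B, hB, fun k => ?_, R - 1, fun k l => ?_, fun k x => ?_⟩
  · have := hdort k k
    simpa only [sqInt, ← hBd, ← sq, if_true] using this
  · have := abs_invSqrt_sub_one_le hA hA1 (by rwa [Fintype.card_fin]) k l
    rwa [Fintype.card_fin] at this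
  · rw [hBd, hd]
    simp only [Matrix.sub_apply, sub_mul, Finset.sum_sub_distrib, Matrix.one_apply]
    simp

theorem sqInt_add_sum_le {r : ℕ} {f : ℝ → ℝ} {g : Fin r → ℝ → ℝ} (hf : Continuous f)
    (hg : ∀ l, Continuous (g l)) {s : Fin r → ℝ} {b c : ℝ} (hs : ∀ l, |s l| ≤ b)
    (hc : ∀ l, sqInt (g l) ≤ c) :
    sqInt (fun x => f x + ∑ l, s l * g l x) ≤ 2 * sqInt f + 2 * (r ^ 2 * (b ^ 2 * c)) := by
  refine (sqInt_add_le hf (by fun_prop)).trans ?_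
  have h : sqInt (fun x => ∑ l, s l * g l x) ≤ r ^ 2 * (b ^ 2 * c) := by
    have h1 : sqInt (fun x => ∑ l, s l * g l x) ≤
        ∫ x in (0 : ℝ)..1, ∑ l, r * (s l ^ 2 * g l x ^ 2) := by
      refine intervalIntegral.integral_mono_on zero_le_one
        (Continuous.intervalIntegrable (by fun_prop) _ _)
        (Continuous.intervalIntegrable (by fun_prop) _ _) fun x _ => ?_
      refine sq_sum_le_card_mul_sum_sq.trans ?_
      rw [Finset.mul_sum, Finset.card_univ, Fintype.card_fin]
      exact Finset.sum_le_sum fun l _ => by rw [mul_pow]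
    refine h1.trans ?_
    rw [intervalIntegral.integral_finsetSum
      fun k _ => Continuous.intervalIntegrable (by fun_prop) _ _]
    have h2 : ∀ l, ∫ x in (0 : ℝ)..1, r * (s l ^ 2 * g l x ^ 2) ≤ r * (b ^ 2 * c) := by
      intro l
      rw [intervalIntegral.integral_const_mul, intervalIntegral.integral_const_mul]
      refine mul_le_mul_of_nonneg_left (mul_le_mul
        (sq_le_sq' (by linarith [(abs_le.1 (hs l)).1]) (abs_le.1 (hs l)).2) (hc l)
        (sqInt_nonneg _) (sq_nonneg _)) (by positivity)
    refine (Finset.sum_le_sum fun l _ => h2 l).trans (le_of_eq ?_)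
    simp
    ring
  linarith

/-- The quasi-interpolation error of the eigenfunctions is bounded by the error of every kernel
whose eigenfunctions are splines. -/
theorem sqInt_sub_quasiInterp_le_hsNorm {n r : ℕ} (hn : 0 < n) {a : Fin r → ℝ}
    {f : Fin r → ℝ → ℝ} (hf : ∀ k, Continuous (f k))
    (hort : ∀ k l, ∫ x in (0 : ℝ)..1, f k x * f l x = if k = l then 1 else 0)
    (B : Matrix (Fin (n + 3)) (Fin r) ℝ) (L : Fin r → ℝ) {k : Fin r} (hk : a k ≠ 0) :
    a k ^ 2 * sqInt (fun x => quasiInterp n (f k) x - f k x) ≤ (2 + 32 * 16000 ^ 2) *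
      hsNorm (finiteKernel a f - modelKernel B L) ^ 2 := by
  have hψ := continuous_psiStar hn B
  have hDc : Continuous (Function.uncurry (finiteKernel a f - modelKernel B L)) :=
    (continuous_finiteKernel a hf).sub (continuous_finiteKernel L hψ)
  have h1 := sqInt_integral_le hDc (hf k)
  have hfk : sqInt (f k) = 1 := by simpa [sqInt, sq] using hort k k
  rw [hfk, mul_one] at h1
  obtain ⟨c, hc⟩ := exists_psiStar_eq_sum hn B
  -- Coefficients of the spline obtained by applying the model kernel to `f k` and dividing by `a
  -- k`.
  let b : ℕ → ℝ := fun j =>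
    (a k)⁻¹ * ∑ l, L l * (∫ v in (0 : ℝ)..1, psiStar B l v * f k v) * c l j
  have h2 : ∀ u, ∫ v in (0 : ℝ)..1, (finiteKernel a f - modelKernel B L) u v * f k v =
      a k * (f k u - ∑ j ∈ Finset.range (n + 3), b j * uniformSpline n j u) := by
    intro u
    have hi1 : IntervalIntegrable (fun v => finiteKernel a f u v * f k v) volume 0 1 :=
      ((((continuous_finiteKernel a hf).comp
        (by fun_prop : Continuous fun v => (u, v)))).mul (hf k)).intervalIntegrable _ _
    have hi2 : IntervalIntegrable (fun v => modelKernel B L u v * f k v) volume 0 1 :=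
      ((((continuous_finiteKernel L hψ).comp
        (by fun_prop : Continuous fun v => (u, v)))).mul (hf k)).intervalIntegrable _ _
    simp only [Pi.sub_apply, sub_mul]
    rw [intervalIntegral.integral_sub hi1 hi2, integral_finiteKernel_mul a hf (hf k)]
    have e2 : ∫ v in (0 : ℝ)..1, modelKernel B L u v * f k v = _ :=
      integral_finiteKernel_mul L hψ (hf k) u
    rw [e2, mul_sub]
    congr 1
    · simp [hort]
    · simp only [b, hc, Finset.mul_sum, Finset.sum_mul]
      rw [Finset.sum_comm]
      refine Finset.sum_congr rfl fun j _ => Finset.sum_congr rfl fun l _ => ?_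
      field_simp
  simp only [h2] at h1
  rw [sqInt_const_mul] at h1
  have h3 := sqInt_sub_quasiInterp_le hn (hf k) b
  nlinarith [mul_le_mul_of_nonneg_left h3 (sq_nonneg (a k))]

/-! ### Optimal parameters with a uniform rate -/

/-- One matrix `B` must serve both rates. The link is the `L²` error `ε` of the quasi-interpolants:
it is `O(n⁻⁴)`, which gives the uniform bounds, and it is dominated by the error of every
competitor, which gives the last bound. -/
theorem exists_spline_approximation {r : ℕ} (hr : 1 ≤ r) {a : Fin r → ℝ} (ha : ∀ k, 0 < a k)
    {f : Fin r → ℝ → ℝ} (hf : ∀ k, Continuous (f k))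
    (hort : ∀ k l, ∫ x in (0 : ℝ)..1, f k x * f l x = if k = l then 1 else 0) {C : ℝ}
    (hC : 0 ≤ C)
    (hcubic : ∀ k, ∀ x ∈ Icc (0 : ℝ) 1, ∃ p : ℕ → ℝ, ∀ y ∈ Icc (0 : ℝ) 1,
      |f k y - ∑ j ∈ Finset.range 4, p j * y ^ j| ≤ C * |y - x| ^ 4) :
    ∃ K : ℝ, 0 ≤ K ∧ ∀ᶠ n : ℕ in atTop, ∃ B : Matrix (Fin (n + 3)) (Fin r) ℝ, Bᵀ * B = 1 ∧
      (∀ k, ∀ x ∈ Icc (0 : ℝ) 1, |f k x - psiStar B k x| ≤ K / (n : ℝ) ^ 4) ∧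
      (∀ u ∈ Icc (0 : ℝ) 1, ∀ v ∈ Icc (0 : ℝ) 1,
        |finiteKernel a f u v - modelKernel B a u v| ≤ K / (n : ℝ) ^ 4) ∧
      ∀ (B' : Matrix (Fin (n + 3)) (Fin r) ℝ) (L : Fin r → ℝ),
        hsNorm (finiteKernel a f - modelKernel B a) ≤
          K * hsNorm (finiteKernel a f - modelKernel B' L) := by
  have hf1 : ∀ k, sqInt (f k) = 1 := fun k => by simpa [sqInt, sq] using hort k k
  have hr1 : (1 : ℝ) ≤ r := by exact_mod_cast hr
  -- bounds for the eigenvalues and the eigenfunctions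
  have hsup : ∃ c : ℝ, 0 ≤ c ∧ ∀ k, ∀ x ∈ Icc (0 : ℝ) 1, |f k x| ≤ c := by
    have h : ∀ k, ∃ c : ℝ, ∀ x ∈ Icc (0 : ℝ) 1, |f k x| ≤ c := fun k => by
      obtain ⟨c, hc⟩ := isCompact_Icc.exists_bound_of_continuousOn
        (s := Icc (0 : ℝ) 1) (hf k).continuousOn
      exact ⟨c, hc⟩
    choose c hc using h
    refine ⟨∑ k, |c k|, Finset.sum_nonneg fun _ _ => abs_nonneg _, fun k x hx => ?_⟩
    exact ((hc k x hx).trans (le_abs_self _)).trans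
      (Finset.single_le_sum (f := fun k => |c k|) (fun _ _ => abs_nonneg _) (Finset.mem_univ k))
  obtain ⟨c, hc0, hc⟩ := hsup
  obtain ⟨b, hb⟩ : ∃ b : ℝ, ∀ k, |a k| ≤ b := ⟨∑ k, |a k|, fun k =>
    Finset.single_le_sum (f := fun k => |a k|) (fun _ _ => abs_nonneg _) (Finset.mem_univ k)⟩
  obtain ⟨α, hα0, hα⟩ : ∃ α : ℝ, 0 < α ∧ ∀ k, α ≤ a k ^ 2 := by
    have : Nonempty (Fin r) := ⟨⟨0, hr⟩⟩
    obtain ⟨k, hk⟩ := Finite.exists_min fun k => a k ^ 2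
    exact ⟨a k ^ 2, pow_pos (ha k) 2, hk⟩
  set C₁ : ℝ := 16000 * (C * 256) with hC₁
  have hC₁0 : 0 ≤ C₁ := by positivity
  -- the two constants
  set K₁ : ℝ := C₁ + r * (6 * r * (r * C₁) * (c + C₁)) with hK₁
  -- `Γ ε²` bounds the squared Hilbert–Schmidt error of the approximant; the factor multiplying `Γ`
  -- in `K₂` bounds `ε²` by the squared error of a competitor.
  set Γ : ℝ := 4 * r ^ 2 * b ^ 2 * (2 + 2 * (r ^ 2 * ((6 * r) ^ 2 * 4))) with hΓ
  set K₂ : ℝ := Real.sqrt (Γ * (r * ((2 + 32 * 16000 ^ 2) / α))) with hK₂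
  have hΓ0 : 0 ≤ Γ := by positivity
  have hK₁0 : 0 ≤ K₁ := by positivity
  have hb0 : 0 ≤ b := (abs_nonneg _).trans (hb ⟨0, hr⟩)
  set K₃ : ℝ := r * (b * (2 * c + K₁) * K₁) with hK₃
  refine ⟨max (max K₁ K₃) K₂, le_max_of_le_left (le_max_of_le_left hK₁0), ?_⟩
  -- Makes `δ`, `r δ` and `6 r (r δ)` at most one, so that the Gram matrix is close enough to the
  -- identity.
  have hsmall : ∀ᶠ n : ℕ in atTop, 6 * r * (r * C₁) + C₁ + r * C₁ ≤ (n : ℝ) :=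
    tendsto_natCast_atTop_atTop.eventually_ge_atTop _
  filter_upwards [hsmall, eventually_gt_atTop 0] with n hn1 hn
  have hn0 : (1 : ℝ) ≤ n := by exact_mod_cast hn
  have hn4 : (n : ℝ) ≤ (n : ℝ) ^ 4 := le_self_pow₀ hn0 (by norm_num)
  have hn4' : (0 : ℝ) < (n : ℝ) ^ 4 := by positivity
  set δ : ℝ := C₁ / (n : ℝ) ^ 4 with hδ
  have hδ0 : 0 ≤ δ := by positivity
  have hdiff : ∀ k, Continuous fun x => quasiInterp n (f k) x - f k x := fun k =>
    (continuous_quasiInterp _ _).sub (hf k)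
  have hQδ : ∀ k, ∀ x ∈ Icc (0 : ℝ) 1, |quasiInterp n (f k) x - f k x| ≤ δ := fun k x hx =>
    abs_quasiInterp_sub_le hn (hf k) hC (hcubic k) hx
  -- The actual `L²` error rather than its bound `r δ`: only the former compares with the best
  -- approximation.
  set ε : ℝ := Real.sqrt (∑ k, sqInt fun x => quasiInterp n (f k) x - f k x) with hε
  have hε2 : ε ^ 2 = ∑ k, sqInt fun x => quasiInterp n (f k) x - f k x :=
    Real.sq_sqrt (Finset.sum_nonneg fun _ _ => sqInt_nonneg _)
  have hε0 : 0 ≤ ε := Real.sqrt_nonneg _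
  have hεk : ∀ k, sqInt (fun x => quasiInterp n (f k) x - f k x) ≤ ε ^ 2 := fun k => by
    rw [hε2]
    exact Finset.single_le_sum (f := fun k => sqInt fun x => quasiInterp n (f k) x - f k x)
      (fun _ _ => sqInt_nonneg _) (Finset.mem_univ k)
  have hεδ : ε ≤ r * δ := by
    refine abs_le_of_sq_le_sq' ?_ (by positivity) |>.2
    rw [hε2]
    refine (Finset.sum_le_sum fun k _ => sqInt_le (hdiff k) (hQδ k)).trans ?_
    simp only [Finset.sum_const, Finset.card_univ, Fintype.card_fin, nsmul_eq_mul]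
    nlinarith [mul_nonneg (sub_nonneg.2 hr1) (mul_nonneg (by positivity : (0:ℝ) ≤ r) (sq_nonneg δ))]
  have hp1 : 0 ≤ 6 * r * (r * C₁) := by positivity
  have hp2 : 0 ≤ r * C₁ := by positivity
  have hδ1 : δ ≤ 1 := by
    rw [hδ, div_le_one hn4']
    linarith
  have hrδ1 : r * δ ≤ 1 := by
    rw [hδ, ← mul_div_assoc, div_le_one hn4']
    linarith
  have hrδ2 : 6 * r * (r * δ) ≤ 1 := by
    have : 6 * r * (r * δ) = 6 * r * (r * C₁) / (n : ℝ) ^ 4 := by rw [hδ]; ring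
    rw [this, div_le_one hn4']
    linarith
  have hrε : r * (3 * ε) ≤ 1 / 2 := by
    nlinarith [mul_le_mul_of_nonneg_left hεδ (by positivity : (0 : ℝ) ≤ 6 * r)]
  obtain ⟨B, hB, hB1, S, hS, hBS⟩ :=
    exists_orthonormal_splines hn hf hort hε0 (hεδ.trans hrδ1) hεk hrε
  have hS' : ∀ k l, |S k l| ≤ 6 * r * ε := fun k l => (hS k l).trans (le_of_eq (by ring))
  have hsub : ∀ k x, psiStar B k x - f k x = (quasiInterp n (f k) x - f k x) +
      ∑ l, S l k * quasiInterp n (f l) x := fun k x => by rw [hBS]; ring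
  have hψ : ∀ k, ∀ x ∈ Icc (0 : ℝ) 1, |f k x - psiStar B k x| ≤ K₁ / (n : ℝ) ^ 4 := by
    intro k x hx
    rw [abs_sub_comm, hsub]
    have hterm : ∀ l, |S l k * quasiInterp n (f l) x| ≤ 6 * r * (r * δ) * (c + C₁) := by
      intro l
      rw [abs_mul]
      refine mul_le_mul ((hS' l k).trans ?_) ?_ (abs_nonneg _) (by positivity)
      · exact mul_le_mul_of_nonneg_left hεδ (by positivity)
      · have h1 := hQδ l x hx
        have h2 := hc l x hx
        have h3 : δ ≤ C₁ := div_le_self hC₁0 (hn0.trans hn4)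
        have h4 := abs_add_le (quasiInterp n (f l) x - f l x) (f l x)
        rw [sub_add_cancel] at h4
        linarith
    have hsum : |∑ l, S l k * quasiInterp n (f l) x| ≤ r * (6 * r * (r * δ) * (c + C₁)) := by
      refine (Finset.abs_sum_le_sum_abs _ _).trans ((Finset.sum_le_sum fun l _ => hterm l).trans ?_)
      simp
    refine (abs_add_le _ _).trans ((add_le_add (hQδ k x hx) hsum).trans ?_)
    have : δ + r * (6 * r * (r * δ) * (c + C₁)) = K₁ / (n : ℝ) ^ 4 := by
      rw [hδ, hK₁]; ring
    exact this.le
  refine ⟨B, hB, fun k x hx => (hψ k x hx).trans ?_, fun u hu v hv => ?_, fun B' L => ?_⟩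
  · exact div_le_div_of_nonneg_right (le_max_of_le_left (le_max_left _ _)) hn4'.le
  · refine (abs_finiteKernel_sub_le (g := psiStar B) hb (fun k => hc k u hu) (fun k => hc k v hv)
      (fun k => hψ k u hu) fun k => hψ k v hv).trans ?_
    calc r * (b * (2 * c + K₁ / (n : ℝ) ^ 4) * (K₁ / (n : ℝ) ^ 4))
        ≤ r * (b * (2 * c + K₁) * (K₁ / (n : ℝ) ^ 4)) := by
          have : K₁ / (n : ℝ) ^ 4 ≤ K₁ := div_le_self hK₁0 (hn0.trans hn4)
          gcongr
      _ = K₃ / (n : ℝ) ^ 4 := by rw [hK₃]; ring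
      _ ≤ _ := div_le_div_of_nonneg_right (le_max_of_le_left (le_max_right _ _)) hn4'.le
  · set H := hsNorm (finiteKernel a f - modelKernel B' L) with hH
    have hH0 : 0 ≤ H := hsNorm_nonneg _
    have hQ4 : ∀ l, sqInt (quasiInterp n (f l)) ≤ 4 := by
      intro l
      have e : quasiInterp n (f l) = fun x => (quasiInterp n (f l) x - f l x) + f l x := by
        ext x; ring
      rw [e]
      refine (sqInt_add_le (hdiff l) (hf l)).trans ?_
      have h1 := hεk l
      have h2 : ε ^ 2 ≤ 1 := pow_le_one₀ hε0 (hεδ.trans hrδ1)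
      rw [hf1]
      linarith
    have herr : ∀ k, sqInt (fun x => psiStar B k x - f k x) ≤
        (2 + 2 * (r ^ 2 * ((6 * r) ^ 2 * 4))) * ε ^ 2 := by
      intro k
      simp only [hsub]
      refine (sqInt_add_sum_le (hdiff k) (fun l => continuous_quasiInterp _ _)
        (fun l => hS' l k) hQ4).trans ?_
      have := hεk k
      nlinarith
    have hup := hsNorm_sq_finiteKernel_sub_le hf (continuous_psiStar hn B) hf1 hB1 hb herr
    have hlow : ε ^ 2 ≤ r * ((2 + 32 * 16000 ^ 2) / α) * H ^ 2 := by
      rw [hε2]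
      have hk : ∀ k, sqInt (fun x => quasiInterp n (f k) x - f k x) ≤
          (2 + 32 * 16000 ^ 2) / α * H ^ 2 := by
        intro k
        have h1 := sqInt_sub_quasiInterp_le_hsNorm hn hf hort B' L (ha k).ne'
        rw [div_mul_eq_mul_div, le_div_iff₀ hα0, mul_comm]
        exact (mul_le_mul_of_nonneg_right (hα k) (sqInt_nonneg _)).trans h1
      refine (Finset.sum_le_sum fun k _ => hk k).trans (le_of_eq ?_)
      simp
      ring
    have hK₂sq : K₂ ^ 2 = Γ * (r * ((2 + 32 * 16000 ^ 2) / α)) := Real.sq_sqrt (by positivity)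
    have h : hsNorm (finiteKernel a f - modelKernel B a) ^ 2 ≤ (K₂ * H) ^ 2 := by
      rw [mul_pow, hK₂sq]
      refine hup.trans ?_
      calc 4 * r ^ 2 * b ^ 2 * ((2 + 2 * (r ^ 2 * ((6 * r) ^ 2 * 4))) * ε ^ 2)
          = Γ * ε ^ 2 := by rw [hΓ]; ring
        _ ≤ Γ * (r * ((2 + 32 * 16000 ^ 2) / α) * H ^ 2) := mul_le_mul_of_nonneg_left hlow hΓ0
        _ = _ := by ring
    have h' := (abs_le_of_sq_le_sq' h (mul_nonneg (Real.sqrt_nonneg _) hH0)).2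
    exact h'.trans (mul_le_mul_of_nonneg_right (le_max_right _ _) hH0)

/-! ### The sampled covariance matrices -/

theorem frobNorm_le {p : ℕ} {A : Matrix (Fin p) (Fin p) ℝ} {τ : ℝ} (hτ : 0 ≤ τ)
    (h : ∀ i j, |A i j| ≤ τ) : frobNorm A ≤ p * τ := by
  rw [frobNorm, Matrix.frobenius_norm_def, ← Real.sqrt_eq_rpow]
  refine Real.sqrt_le_iff.2 ⟨by positivity, ?_⟩
  have h1 : ∀ i j, ‖A i j‖ ^ (2 : ℝ) ≤ τ ^ 2 := fun i j => by
    rw [Real.rpow_two]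
    exact pow_le_pow_left₀ (norm_nonneg _) (h i j) 2
  refine (Finset.sum_le_sum fun i _ => Finset.sum_le_sum fun j _ => h1 i j).trans (le_of_eq ?_)
  simp
  ring

theorem trueCov_sub_approxCov_apply {N r p : ℕ} (Sig : ℝ → ℝ → ℝ) (B : Matrix (Fin N) (Fin r) ℝ)
    (L : Fin r → ℝ) (σ : ℝ) (t : Fin p → ℝ) (i j : Fin p) :
    (trueCov Sig σ t - approxCov B L σ t) i j = Sig (t i) (t j) - modelKernel B L (t i) (t j) := by
  have h1 : ∀ i k, ((designMatrix N t)ᵀ * B) i k = psiStar B k (t i) := fun i k => rfl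
  have h2 : ∀ j k, (Bᵀ * designMatrix N t) k j = psiStar B k (t j) := fun j k => by
    simp only [Matrix.mul_apply, Matrix.transpose_apply, psiStar, Matrix.vecMul, dotProduct,
      designMatrix, Matrix.of_apply, mul_comm]
  have h3 : ((designMatrix N t)ᵀ * B * Matrix.diagonal L * Bᵀ * designMatrix N t) i j =
      modelKernel B L (t i) (t j) := by
    rw [Matrix.mul_assoc, Matrix.mul_apply, modelKernel]
    refine Finset.sum_congr rfl fun k _ => ?_
    rw [Matrix.mul_diagonal, h1, h2]
    ring
  rw [Matrix.sub_apply, trueCov, approxCov, Matrix.add_apply, Matrix.add_apply, h3, Matrix.of_apply]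
  ring

/-- The noise terms cancel, and a square matrix of size `m i` with entries at most `τ` has Frobenius
norm at most `m i * τ`. -/
theorem maxApproxError_le {N r n : ℕ} {Sig : ℝ → ℝ → ℝ} {B : Matrix (Fin N) (Fin r) ℝ}
    {L : Fin r → ℝ} {σ τ : ℝ} (hτ : 0 ≤ τ) {m : Fin n → ℕ} {t : (i : Fin n) → Fin (m i) → ℝ}
    (h : ∀ i j j', |Sig (t i j) (t i j') - modelKernel B L (t i j) (t i j')| ≤ τ) :
    maxApproxError Sig B L σ t ≤ τ := by
  refine Real.iSup_le (fun i => ?_) hτ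
  have h1 : frobNorm (trueCov Sig σ (t i) - approxCov B L σ (t i)) ≤ m i * τ :=
    frobNorm_le hτ fun j j' => by
      rw [trueCov_sub_approxCov_apply]
      exact h i j j'
  rcases Nat.eq_zero_or_pos (m i) with h0 | h0
  · simpa [h0] using hτ
  · have h0' : (0 : ℝ) < m i := by exact_mod_cast h0
    rw [one_div, inv_mul_le_iff₀ h0']
    exact h1

/-- The kernels are compared only on the unit square, so the design must stay there almost surely.
-/
theorem CondB2.ae_mem {Ω : Type*} [MeasurableSpace Ω] {P : Measure Ω} {m : (n : ℕ) → Fin n → ℕ}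
    {T : (n : ℕ) → (i : Fin n) → Fin (m n i) → Ω → ℝ} {g : ℝ → ℝ} {cg₀ cg₁ : ℝ}
    (h : CondB2 P T g cg₀ cg₁) (n : ℕ) :
    ∀ᵐ ω ∂P, ∀ i j, T n i j ω ∈ Icc (0 : ℝ) 1 := by
  refine ae_all_iff.2 fun i => ae_all_iff.2 fun j => ?_
  have h1 : ∀ᵐ x ∂(P.map (T n i j)), x ∈ Icc (0 : ℝ) 1 := by
    rw [h.law]
    exact (withDensity_absolutelyContinuous _ _).ae_le (ae_restrict_mem measurableSet_Icc)
  exact ae_of_ae_map (h.measurable n i j).aemeasurable h1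

/-! ### The growth of the number of basis functions -/

theorem tendsto_mul_sq_div_log {b : ℕ → ℕ} (hb : ∀ᶠ n in atTop, 4 ≤ b n) :
    Tendsto (fun n : ℕ => (n : ℝ) * (b n : ℝ) ^ 2 / Real.log n) atTop atTop := by
  have h1 : Tendsto (fun n : ℕ => (n : ℝ) / Real.log n) atTop atTop := by
    have := (Real.isLittleO_log_id_atTop.tendsto_div_nhds_zero).comp
      (tendsto_natCast_atTop_atTop (R := ℝ))
    have h2 : Tendsto (fun n : ℕ => Real.log n / (n : ℝ)) atTop (nhdsWithin 0 (Ioi 0)) := by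
      refine tendsto_nhdsWithin_iff.2 ⟨this, ?_⟩
      filter_upwards [eventually_ge_atTop 2] with n hn
      have : (1 : ℝ) < n := by exact_mod_cast hn
      exact div_pos (Real.log_pos this) (by linarith)
    refine h2.inv_tendsto_nhdsGT_zero.congr fun n => ?_
    simp
  refine tendsto_atTop_mono' _ ?_ h1
  filter_upwards [eventually_ge_atTop 2, hb] with n hn hbn
  have hn1 : (1 : ℝ) < n := by exact_mod_cast hn
  refine div_le_div_of_nonneg_right ?_ (Real.log_pos hn1).le
  have : (4 : ℝ) ≤ b n := by exact_mod_cast hbn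
  exact le_mul_of_one_le_right (by linarith) (one_le_pow₀ (by linarith))

/-- With `X = n b² / log n`, the hypothesis reads `X^(1/9) ≤ c M`. Since `X` tends to infinity, so
does `M`; the ninth power, multiplied by `log n / (n M⁸)`, is the square of the second claim. -/
theorem exists_growth_bounds {b M : ℕ → ℕ} (hb : ∀ᶠ n in atTop, 4 ≤ b n) (hM1 : ∀ n, 1 ≤ M n)
    (hM : (fun n : ℕ => (M n : ℝ)⁻¹ * ((n : ℝ) * (b n : ℝ) ^ 2 / Real.log n) ^ (1 / 9 : ℝ))
      =O[atTop] fun _ => (1 : ℝ)) :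
    Tendsto M atTop atTop ∧ ∃ K : ℝ, 0 ≤ K ∧ ∀ᶠ n : ℕ in atTop,
      (b n : ℝ) / (M n : ℝ) ^ 4 ≤ K * Real.sqrt ((M n : ℝ) * Real.log n / n) := by
  obtain ⟨c, hc⟩ := hM.bound
  have hle : ∀ᶠ n : ℕ in atTop,
      ((n : ℝ) * (b n : ℝ) ^ 2 / Real.log n) ^ (1 / 9 : ℝ) ≤ |c| * M n := by
    filter_upwards [hc] with n hn
    have h0 : (0 : ℝ) < M n := by exact_mod_cast hM1 n
    rw [norm_one, mul_one, Real.norm_eq_abs, abs_mul, abs_of_pos (inv_pos.2 h0),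
      inv_mul_le_iff₀ h0] at hn
    calc _ ≤ _ := le_abs_self _
      _ ≤ _ := hn
      _ ≤ _ := by nlinarith [le_abs_self c]
  constructor
  · have h1 : Tendsto (fun n : ℕ => ((n : ℝ) * (b n : ℝ) ^ 2 / Real.log n) ^ (1 / 9 : ℝ))
        atTop atTop := (tendsto_rpow_atTop (by norm_num)).comp (tendsto_mul_sq_div_log hb)
    have h2 : Tendsto (fun n => |c| * (M n : ℝ)) atTop atTop := tendsto_atTop_mono' _ hle h1
    have h3 : Tendsto (fun n => (M n : ℝ)) atTop atTop := by
      rcases eq_or_lt_of_le (abs_nonneg c) with h | h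
      · simp only [← h, zero_mul] at h2
        exact absurd h2 (not_tendsto_const_atTop _ _)
      · exact (tendsto_const_mul_atTop_of_pos h).1 h2
    exact tendsto_natCast_atTop_iff.1 h3
  · refine ⟨Real.sqrt (|c| ^ 9), Real.sqrt_nonneg _, ?_⟩
    filter_upwards [hle, eventually_ge_atTop 2] with n hn hn2
    have hn1 : (1 : ℝ) < n := by exact_mod_cast hn2
    have hlog := Real.log_pos hn1
    have hM0 : (0 : ℝ) < M n := by exact_mod_cast hM1 n
    have hX : 0 ≤ (n : ℝ) * (b n : ℝ) ^ 2 / Real.log n := by positivity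
    have h9 : (n : ℝ) * (b n : ℝ) ^ 2 / Real.log n ≤ (|c| * M n) ^ 9 := by
      have := pow_le_pow_left₀ (Real.rpow_nonneg hX _) hn 9
      rwa [← Real.rpow_natCast, ← Real.rpow_mul hX, show (1 / 9 : ℝ) * (9 : ℕ) = 1 by norm_num,
        Real.rpow_one] at this
    rw [← Real.sqrt_mul (by positivity)]
    refine Real.le_sqrt_of_sq_le ?_
    rw [div_le_iff₀ hlog] at h9
    have hn0 : (0 : ℝ) < n := by linarith
    rw [div_pow, div_le_iff₀ (by positivity), ← mul_div_assoc, div_mul_eq_mul_div,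
      le_div_iff₀ hn0]
    calc (b n : ℝ) ^ 2 * n = n * (b n : ℝ) ^ 2 := by ring
      _ ≤ _ := h9
      _ = _ := by ring

/-! ### Finite rank and comparison with the best approximation error. -/

theorem setOf_lam_ne_zero {r : ℕ} {lam : ℕ → ℝ} (hnonneg : ∀ k, 0 ≤ lam k)
    (hrank : spectralRank lam = r) (hstrict : ∀ k < r, lam (k + 1) < lam k) :
    {k | lam k ≠ 0} = (Finset.range r : Set ℕ) := by
  -- Strict decrease above nonnegative values makes the first `r` eigenvalues positive; the count
  -- leaves no others.
  have hsub : (Finset.range r : Set ℕ) ⊆ {k | lam k ≠ 0} := fun k hk =>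
    ((hnonneg (k + 1)).trans_lt (hstrict k (by simpa using hk))).ne'
  refine ((Finset.finite_toSet _).eq_of_subset_of_encard_le hsub ?_).symm
  rw [Set.encard_coe_eq_coe_finsetCard, Finset.card_range]
  exact hrank.le

theorem IsSpectralDecomposition.eq_finiteKernel {r : ℕ} {Sig : ℝ → ℝ → ℝ} {lam : ℕ → ℝ}
    {psi : ℕ → ℝ → ℝ} (h : IsSpectralDecomposition Sig lam psi)
    (hlam : {k | lam k ≠ 0} = (Finset.range r : Set ℕ)) {u v : ℝ} (hu : u ∈ Icc (0 : ℝ) 1)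
    (hv : v ∈ Icc (0 : ℝ) 1) :
    Sig u v = finiteKernel (fun k : Fin r => lam k) (fun k => psi k) u v := by
  have h0 : ∀ k ∉ Finset.range r, lam k * psi k u * psi k v = 0 := by
    intro k hk
    have : lam k = 0 := by
      by_contra hne
      have : k ∈ {k | lam k ≠ 0} := hne
      rw [hlam] at this
      exact hk this
    rw [this]
    ring
  rw [(h.expansion u hu v hv).unique (hasSum_sum_of_ne_finset_zero h0), Finset.sum_range,
    finiteKernel]

/-- The best approximation error is attained up to a factor by a kernel that is up to this factor
at least as good as every other one. -/
theorem isTheta_bestApproxError {r : ℕ} {Sig : ℝ → ℝ → ℝ}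
    {B : ∀ N : ℕ, Matrix (Fin N) (Fin r) ℝ} {L : ℕ → Fin r → ℝ} {K : ℝ} (hK : 0 ≤ K)
    (hmem : ∀ᶠ N in atTop, IsModelParameter (B N) (L N))
    (h : ∀ᶠ N in atTop, ∀ (B' : Matrix (Fin N) (Fin r) ℝ) (L' : Fin r → ℝ),
      hsNorm (Sig - modelKernel (B N) (L N)) ≤ K * hsNorm (Sig - modelKernel B' L')) :
    (fun N : ℕ => hsNorm (Sig - modelKernel (B N) (L N))) =Θ[atTop]
      fun N : ℕ => bestApproxError Sig N r := by
  have hbest0 : ∀ N, 0 ≤ bestApproxError Sig N r := fun N => Real.sInf_nonneg (by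
    rintro _ ⟨C, _, rfl⟩
    exact hsNorm_nonneg _)
  constructor
  · refine IsBigO.of_bound (K + 1) ?_
    filter_upwards [hmem, h] with N hN1 hN2
    rw [Real.norm_of_nonneg (hsNorm_nonneg _), Real.norm_of_nonneg (hbest0 N),
      ← div_le_iff₀' (by linarith)]
    refine le_csInf ⟨_, _, ⟨B N, L N, hN1, rfl⟩, rfl⟩ ?_
    rintro _ ⟨_, ⟨B', L', _, rfl⟩, rfl⟩
    rw [div_le_iff₀' (by linarith)]
    refine (hN2 B' L').trans (mul_le_mul_of_nonneg_right (by linarith) (hsNorm_nonneg _))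
  · refine IsBigO.of_bound 1 ?_
    filter_upwards [hmem] with N hN1
    rw [Real.norm_of_nonneg (hsNorm_nonneg _), Real.norm_of_nonneg (hbest0 N), one_mul]
    refine csInf_le ⟨0, ?_⟩ ⟨_, ⟨B N, L N, hN1, rfl⟩, rfl⟩
    rintro _ ⟨C, _, rfl⟩
    exact hsNorm_nonneg _

end SparseFPCA

/-! ### The main theorem. -/

theorem lemma1
    -- the covariance kernel, its spectral decomposition and its rank
    (r : ℕ) (hr : 1 ≤ r) (Sig : ℝ → ℝ → ℝ) (lam : ℕ → ℝ) (psi : ℕ → ℝ → ℝ)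
    (hSig : SparseFPCA.IsSpectralDecomposition Sig lam psi)
    (hrank : SparseFPCA.spectralRank lam = r)
    (c₁ c₂ C₀ : ℝ) (hA1 : SparseFPCA.CondA1 r lam c₁ c₂) (hA2 : SparseFPCA.CondA2 r psi C₀)
    -- the noise level and the random design
    (σ : ℝ) (hσ : 0 < σ)
    (m : (n : ℕ) → Fin n → ℕ) (mlow mbar : ℕ → ℕ) (d₂ κ : ℝ)
    (hB1 : SparseFPCA.CondB1 m mlow mbar d₂ κ)
    {Ω : Type*} [MeasurableSpace Ω] (P : Measure Ω) [IsProbabilityMeasure P]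
    (T : (n : ℕ) → (i : Fin n) → Fin (m n i) → Ω → ℝ) (g : ℝ → ℝ) (cg₀ cg₁ : ℝ)
    (hB2 : SparseFPCA.CondB2 P T g cg₀ cg₁)
    -- the number of basis functions
    (M : ℕ → ℕ) (hrM : ∀ n, r ≤ M n)
    (hM : (fun n : ℕ => (M n : ℝ)⁻¹ * ((n : ℝ) * (mbar n : ℝ) ^ 2 / Real.log n) ^ (1 / 9 : ℝ))
      =O[atTop] fun _ => (1 : ℝ)) :
    ∃ (B : ∀ N : ℕ, Matrix (Fin N) (Fin r) ℝ) (L : ℕ → Fin r → ℝ),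
      SparseFPCA.IsOptimalParameter Sig B L ∧
      (∃ K : ℝ, ∀ᶠ N : ℕ in atTop, ∀ k : Fin r, ∀ x ∈ Icc (0 : ℝ) 1,
        |psi k x - SparseFPCA.psiStar (B N) k x| ≤ K / (N : ℝ) ^ 4) ∧
      SparseFPCA.CondC P Sig B L σ T mbar M := by

  open SparseFPCA in
  have hlam := setOf_lam_ne_zero hSig.nonneg hrank hA1.strict
  set a : Fin r → ℝ := fun k => lam k with ha
  have ha0 : ∀ k, 0 < a k := fun k => (hSig.nonneg _).trans_lt (hA1.strict k k.2)
  have haanti : StrictAnti a := fun i j hij =>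
    (hSig.antitone (Nat.succ_le_of_lt hij)).trans_lt (hA1.strict i i.2)
  -- the eigenfunctions, extended to continuous functions
  let f : Fin r → ℝ → ℝ := fun k => IccExtend zero_le_one ((Icc (0 : ℝ) 1).domRestrict (psi k))
  have hf : ∀ k, Continuous (f k) := fun k =>
    (hA2.contDiff k k.2).continuousOn.domRestrict.Icc_extend'
  have hfψ : ∀ k : Fin r, ∀ x ∈ Icc (0 : ℝ) 1, f k x = psi k x := fun k x hx =>
    IccExtend_of_mem zero_le_one _ hx
  have hort : ∀ k l, ∫ x in (0 : ℝ)..1, f k x * f l x = if k = l then 1 else 0 := by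
    intro k l
    rw [intervalIntegral.integral_congr (g := fun x => psi k x * psi l x) fun x hx => ?_,
      hSig.orthonormal]
    · simp only [Fin.ext_iff]
    · rw [uIcc_of_le zero_le_one] at hx
      simp only [hfψ _ x hx]
  have hcubic : ∀ k, ∀ x ∈ Icc (0 : ℝ) 1, ∃ p : ℕ → ℝ, ∀ y ∈ Icc (0 : ℝ) 1,
      |f k y - ∑ j ∈ Finset.range 4, p j * y ^ j| ≤ C₀ * |y - x| ^ 4 := by
    intro k x hx
    obtain ⟨p, hp⟩ := exists_cubic_approx (hA2.contDiff k k.2) hA2.pos.le (hA2.bound k k.2) hx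
    exact ⟨p, fun y hy => by rw [hfψ k y hy]; exact hp y hy⟩
  have hSigf : ∀ u ∈ Icc (0 : ℝ) 1, ∀ v ∈ Icc (0 : ℝ) 1, Sig u v = finiteKernel a f u v := by
    intro u hu v hv
    rw [hSig.eq_finiteKernel hlam hu hv, finiteKernel, finiteKernel]
    simp only [hfψ _ u hu, hfψ _ v hv, ha]
  -- The norm sees only the unit square, where `Sig` agrees with this continuous kernel.
  have hhs : ∀ E : ℝ → ℝ → ℝ, hsNorm (finiteKernel a f - E) = hsNorm (Sig - E) := fun E =>
    hsNorm_congr fun u hu v hv => by simp only [Pi.sub_apply, hSigf u hu v hv]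
  obtain ⟨K, hK0, hK⟩ := exists_spline_approximation hr ha0 hf hort hA2.pos.le hcubic
  -- Passage from `n` cells to `N = n + 3` basis functions: `n + 3 ≤ 4 n` for `n ≥ 1`, which costs
  -- `4 ^ 4 = 256`.
  have hex : ∀ᶠ N : ℕ in atTop, ∃ B : Matrix (Fin N) (Fin r) ℝ, Bᵀ * B = 1 ∧
      (∀ k, ∀ x ∈ Icc (0 : ℝ) 1, |f k x - psiStar B k x| ≤ 256 * K / (N : ℝ) ^ 4) ∧
      (∀ u ∈ Icc (0 : ℝ) 1, ∀ v ∈ Icc (0 : ℝ) 1,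
        |finiteKernel a f u v - modelKernel B a u v| ≤ 256 * K / (N : ℝ) ^ 4) ∧
      ∀ (B' : Matrix (Fin N) (Fin r) ℝ) (L : Fin r → ℝ),
        hsNorm (finiteKernel a f - modelKernel B a) ≤
          K * hsNorm (finiteKernel a f - modelKernel B' L) := by
    obtain ⟨n₀, hn₀⟩ := eventually_atTop.1 hK
    filter_upwards [eventually_ge_atTop (n₀ + 1 + 3)] with N hN
    obtain ⟨n, rfl⟩ : ∃ n, N = n + 3 := ⟨N - 3, by omega⟩
    obtain ⟨B, hB1, hB2, hB3, hB4⟩ := hn₀ n (by omega)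
    have hn1 : (1 : ℝ) ≤ n := by exact_mod_cast (by omega : 1 ≤ n)
    have hle : K / (n : ℝ) ^ 4 ≤ 256 * K / ((n + 3 : ℕ) : ℝ) ^ 4 := by
      rw [div_le_div_iff₀ (by positivity) (by positivity)]
      have h4 : ((n + 3 : ℕ) : ℝ) ^ 4 ≤ (4 * (n : ℝ)) ^ 4 :=
        pow_le_pow_left₀ (by positivity) (by push_cast; linarith) 4
      calc K * ((n + 3 : ℕ) : ℝ) ^ 4 ≤ K * (4 * (n : ℝ)) ^ 4 := mul_le_mul_of_nonneg_left h4 hK0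
        _ = _ := by ring
    exact ⟨B, hB1, fun k x hx => (hB2 k x hx).trans hle,
      fun u hu v hv => (hB3 u hu v hv).trans hle, hB4⟩
  choose! B hB using fun (N : ℕ) (h : ∃ B : Matrix (Fin N) (Fin r) ℝ, Bᵀ * B = 1 ∧
      (∀ k, ∀ x ∈ Icc (0 : ℝ) 1, |f k x - psiStar B k x| ≤ 256 * K / (N : ℝ) ^ 4) ∧
      (∀ u ∈ Icc (0 : ℝ) 1, ∀ v ∈ Icc (0 : ℝ) 1,
        |finiteKernel a f u v - modelKernel B a u v| ≤ 256 * K / (N : ℝ) ^ 4) ∧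
      ∀ (B' : Matrix (Fin N) (Fin r) ℝ) (L : Fin r → ℝ),
        hsNorm (finiteKernel a f - modelKernel B a) ≤
          K * hsNorm (finiteKernel a f - modelKernel B' L)) => h
  have hgood := hex.mono hB
  have hmem : ∀ᶠ N : ℕ in atTop, IsModelParameter (B N) a :=
    hgood.mono fun N hN => ⟨hN.1, haanti, ha0⟩
  refine ⟨B, fun _ => a, ⟨hmem, ?_⟩, ⟨256 * K, ?_⟩, ?_⟩
  · refine isTheta_bestApproxError hK0 hmem (hgood.mono fun N hN B' L' => ?_)
    simpa only [hhs] using hN.2.2.2 B' L'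
  · filter_upwards [hgood] with N hN k x hx
    rw [← hfψ k x hx]
    exact hN.2.1 k x hx
  -- The lower bound on `mbar n` passes through some curve, so it needs `n > 0`.
  · have h4 : ∀ᶠ n in atTop, 4 ≤ mbar n := by
      filter_upwards [eventually_gt_atTop 0] with n hn
      have hm := hB1.bounds n ⟨0, hn⟩
      exact (hB1.four_le n).trans (hm.1.trans hm.2)
    obtain ⟨hMtop, K', hK'0, hK'⟩ := exists_growth_bounds h4 (fun n => hr.trans (hrM n)) hM
    refine ⟨256 * K * K', ?_⟩
    filter_upwards [hMtop.eventually hgood, hK'] with n hn hn'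
    filter_upwards [hB2.ae_mem n] with ω hω
    have h1 := maxApproxError_le (Sig := Sig) (B := B (M n)) (L := a) (σ := σ)
      (τ := 256 * K / (M n : ℝ) ^ 4) (by positivity) (t := fun i j => T n i j ω)
      fun i j j' => by
        rw [hSigf _ (hω i j) _ (hω i j')]
        exact hn.2.2.1 _ (hω i j) _ (hω i j')
    calc (mbar n : ℝ) * maxApproxError Sig (B (M n)) a σ (fun i j => T n i j ω)
        ≤ mbar n * (256 * K / (M n : ℝ) ^ 4) := mul_le_mul_of_nonneg_left h1 (by positivity)
      _ = 256 * K * (mbar n / (M n : ℝ) ^ 4) := by ring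
      _ ≤ 256 * K * (K' * Real.sqrt ((M n : ℝ) * Real.log n / n)) :=
        mul_le_mul_of_nonneg_left hn' (by positivity)
      _ = _ := by ring
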